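/- Let $\mathbb K=\mathbb R$ or $\mathbb C$, $m\ge 0$, $a_1,\dots,a_m\in\mathbb K$, $A=\mathrm{diag}(a_1,\dots,a_m)$, $E_\alpha$ the diagonal matrix units, and let $\rho>0$ satisfy $\rho|a_\alpha|<1$ for all $\alpha$. Let $X$ be the Banach space of times $t=(t_{k\alpha})_{k\ge 0,\,1\le\alpha\le m}$ in $\mathbb K$ with $\sum_{k,\alpha}\rho^k|t_{k\alpha}|<\infty$, $\partial_{k\alpha}=\partial/\partial t_{k\alpha}$, and for $\varepsilon\in[0,1]$ let $[\varepsilon a]\in X$ be the point with coordinates $(-1)^{k-1}(\varepsilon a_\alpha)^k/k$ for $k\ge1$ and $0$ for $k=0$. Let $\Omega\subseteq X$ be open with $t+[\varepsilon a]\in\Omega$ for all $t\in\Omega$, $\varepsilon\in[0,1]$ (for instance $\Omega=X$). For functions $\tau$ and $\tau_{\alpha\beta}$ $(\alpha\neq\beta)$ of $t$, put $$\hat w_{\alpha\alpha}(t,z)=\frac{\tau(\dots,t_{k\gamma}-\delta_{\gamma\alpha}\tfrac1k z^{-k},\dots)}{\tau(t)},\qquad \hat w_{\alpha\beta}(t,z)=z^{-1}\frac{\tau_{\alpha\beta}(\dots,t_{k\gamma}-\delta_{\gamma\beta}\tfrac1k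 z^{-k},\dots)}{\tau(t)}\quad(\alpha\ne\beta),$$ where only times with $k\ge1$ are shifted and the right-hand sides are expanded in powers of $z^{-1}$. For an invertible formal series $\hat w=I+\sum_{j\ge1}w_jz^{-j}$ put $R_\alpha=\hat wE_\alpha\hat w^{-1}$ and $B_{k\alpha}=(z^kR_\alpha)_+$, the part with non-negative powers of $z$. Suppose that $\tau$, with the $\tau_{\alpha\beta}$, is a $\tau$-function of the classical AKNS-D hierarchy on $\Omega$, that is, $\tau$ and the $\tau_{\alpha\beta}$ are analytic on $\Omega$ and, at the points of $\Omega$ with $\tau\neq0$, the formal function $w=\hat w\exp\bigl(\sum_{k\ge0}\sum_\alpha z^kE_\alpha t_{k\alpha}\bigr)$ is a classical Baker function: $\hat w=I+O(z^{-1})$, $\partial_{k\alpha}w=B_{k\alpha}w$ for all $k\ge0$ and $\alpha$, and $(\partial_x-zA+U)(w)=0$ for some matrix function $U$ of $t$ with zero diagonal, where $\partial_x=\sum_\alpha a_\alpha\partial_{1\alpha}$. For $n\in\mathbb Z$ set $\tau_D(n;t)=\tau(t')$ and $(\tau_D)_{\alpha\beta}(n;t)=\tau_{\alpha\beta}(t')$,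 where $t'_{k\alpha}=t_{k\alpha}+n\frac{(-1)^{k-1}}{k}a_\alpha^k$ for $k\ge1$ and $t'_{0\alpha}=t_{0\alpha}$; let $\hat w_D(n;t,z)$ be given by the formulas above with $\tau_D,(\tau_D)_{\alpha\beta}$ in place of $\tau,\tau_{\alpha\beta}$, on the set $D_n$ of those $t$ with $t'\in\Omega$ and $\tau_D(n;t)\ne0$, and put $$w_D=\hat w_D\,(1+zA)^n\exp\Bigl(\sum_{k\ge0}\sum_\alpha z^kE_\alpha t_{k\alpha}\Bigr).$$ Then $w_D$ is a Baker function of the discrete AKNS-D hierarchy. That is, with $(\Lambda f)(n)=f(n+1)$, $\Delta=\Lambda-1$ and $R_\alpha$, $B_{k\alpha}$ formed from $\hat w_D$: one has $\hat w_D=I+O(z^{-1})$ and $\partial_{k\alpha}w_D=B_{k\alpha}w_D$ on $D_n$ for all $n\in\mathbb Z$, $k\ge 0$ and $\alpha$, and there is an operator $L_D=\Delta-zA+U$ with an $m\times m$ matrix function $U=U(n;t)$, not depending on $z$, such that for all $n\in\mathbb Z$ and $t\in D_n\cap D_{n+1}$ $$L_D\hat w_D=(\Lambda\hat w_D)(\Delta-zA),\qquad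 L_D(w_D)=0,\qquad \partial_{k\alpha}L_D=[B_{k\alpha},L_D]_D:=(\Lambda B_{k\alpha})L_D-L_DB_{k\alpha}$$ for all $k\ge0$ and $\alpha$. -/

import Mathlib

open scoped PowerSeries LaurentSeries

namespace AKNSD

/-! ### Times

A time sequence `t = (t_{kα})`, `k ≥ 0`, `1 ≤ α ≤ m`, with `∑ ρ ^ k * ‖t_{kα}‖ < ∞` is stored as
the point `x` of `ℓ¹` with coordinates `x_{kα} = ρ ^ k * t_{kα}`. -/

/-- The Banach space of times. -/
abbrev Times (𝕜 : Type*) [RCLike 𝕜] (m : ℕ) : Type _ := lp (fun _ : ℕ × Fin m => 𝕜) 1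

open Classical in
/-- The point of the space of times with given times `t_{kα} = t (k, α)`
(junk value `0` if `∑ ρ ^ k * ‖t_{kα}‖ = ∞`). -/
noncomputable def ofTimes {𝕜 : Type*} [RCLike 𝕜] {m : ℕ} (ρ : ℝ) (t : ℕ × Fin m → 𝕜) :
    Times 𝕜 m :=
  if h : Memℓp (fun i : ℕ × Fin m => (ρ : 𝕜) ^ i.1 * t i) 1 then ⟨_, h⟩ else 0

/-- The unit vector in the direction of `t_{kα}`. -/
noncomputable def timeDir (𝕜 : Type*) [RCLike 𝕜] {m : ℕ} (ρ : ℝ) (k : ℕ) (α : Fin m) :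
    Times 𝕜 m :=
  ofTimes ρ (Pi.single (k, α) 1)

/-- The Sato shift: the times `ζ ^ k / k` (`k ≥ 1`) in the component `β`, and zero elsewhere.
Here `ζ` stands for `z⁻¹`. -/
noncomputable def satoVec {𝕜 : Type*} [RCLike 𝕜] {m : ℕ} (ρ : ℝ) (β : Fin m) (ζ : 𝕜) :
    Times 𝕜 m :=
  ofTimes ρ fun i => if 1 ≤ i.1 ∧ i.2 = β then ζ ^ i.1 / (i.1 : 𝕜) else 0

/-- The discrete shift: the times `(-1) ^ (k - 1) * a_α ^ k / k` for `k ≥ 1`, and zero for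
`k = 0`. -/
noncomputable def stepVec {𝕜 : Type*} [RCLike 𝕜] {m : ℕ} (ρ : ℝ) (a : Fin m → 𝕜) :
    Times 𝕜 m :=
  ofTimes ρ fun i => if 1 ≤ i.1 then (-1) ^ (i.1 - 1) * a i.2 ^ i.1 / (i.1 : 𝕜) else 0

/-! ### Formal series

Power series in the variable `ζ = z⁻¹`, seen inside Laurent series in `ζ`; the latter are the
formal series in `z` with finitely many positive powers of `z`. -/

/-- The spectral parameter `z`. -/
noncomputable def zvar (𝕜 : Type*) [RCLike 𝕜] : 𝕜⸨X⸩ := HahnSeries.single (-1 : ℤ) (1 : 𝕜)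

/-- `f₊`: the terms of `f` with non-negative powers of `z`. -/
noncomputable def plusPart {𝕜 : Type*} [RCLike 𝕜] (f : 𝕜⸨X⸩) : 𝕜⸨X⸩ :=
  HahnSeries.truncLT (1 : ℤ) f

/-- A matrix of power series in `z⁻¹` as a matrix of Laurent series. -/
noncomputable def toLaurent {𝕜 : Type*} [RCLike 𝕜] {m : ℕ} (W : Matrix (Fin m) (Fin m) 𝕜⟦X⟧) :
    Matrix (Fin m) (Fin m) 𝕜⸨X⸩ :=
  W.map (HahnSeries.ofPowerSeries ℤ 𝕜)

/-- A matrix of scalars as a matrix of (constant) Laurent series. -/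
noncomputable def constMat {𝕜 : Type*} [RCLike 𝕜] {m : ℕ} (U : Matrix (Fin m) (Fin m) 𝕜) :
    Matrix (Fin m) (Fin m) 𝕜⸨X⸩ :=
  U.map HahnSeries.C

/-- `z * A` with `A = diag(a_1, …, a_m)`. -/
noncomputable def zA {𝕜 : Type*} [RCLike 𝕜] {m : ℕ} (a : Fin m → 𝕜) :
    Matrix (Fin m) (Fin m) 𝕜⸨X⸩ :=
  zvar 𝕜 • constMat (Matrix.diagonal a)

/-- The matrix unit `E_α`. -/
noncomputable def unitMat (𝕜 : Type*) [RCLike 𝕜] {m : ℕ} (α : Fin m) :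
    Matrix (Fin m) (Fin m) 𝕜⸨X⸩ :=
  Matrix.single α α 1

/-- The resolvent `R_α = ŵ E_α ŵ⁻¹`. -/
noncomputable def resolvent {𝕜 : Type*} [RCLike 𝕜] {m : ℕ} (W : Matrix (Fin m) (Fin m) 𝕜⟦X⟧)
    (α : Fin m) : Matrix (Fin m) (Fin m) 𝕜⸨X⸩ :=
  toLaurent W * unitMat 𝕜 α * (toLaurent W)⁻¹

/-- `B_{kα} = (z ^ k R_α)₊`. -/
noncomputable def Bmat {𝕜 : Type*} [RCLike 𝕜] {m : ℕ} (W : Matrix (Fin m) (Fin m) 𝕜⟦X⟧)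
    (k : ℕ) (α : Fin m) : Matrix (Fin m) (Fin m) 𝕜⸨X⸩ :=
  (zvar 𝕜 ^ k • resolvent W α).map plusPart

/-- The coefficientwise partial derivative `∂_{kα} ŵ` of a family of matrices of power series. -/
noncomputable def partialW {𝕜 : Type*} [RCLike 𝕜] {m : ℕ} (ρ : ℝ) (k : ℕ) (α : Fin m)
    (W : Times 𝕜 m → Matrix (Fin m) (Fin m) 𝕜⟦X⟧) (t : Times 𝕜 m) :
    Matrix (Fin m) (Fin m) 𝕜⟦X⟧ :=
  Matrix.of fun p q => PowerSeries.mk fun j =>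
    lineDeriv 𝕜 (fun s => PowerSeries.coeff j (W s p q)) t (timeDir 𝕜 ρ k α)

/-! ### Baker functions

A formal Baker function is a product `w = ŵ g` with `ŵ = I + ∑_{j ≥ 1} w_j z⁻ʲ` and `g` equal to
`exp (∑ z ^ k E_α t_{kα})` in the classical case and to `(1 + z A) ^ n exp (∑ z ^ k E_α t_{kα})`
in the discrete case. A product `F g` is represented by its left factor `F`; as
`∂_{kα} g = z ^ k E_α g` and `g(n + 1) = (1 + z A) g(n)`, the operators act on left factors by
`∂_{kα} (F g) = (∂_{kα} F + F z ^ k E_α) g` and `Λ (F g) = (Λ F) (1 + z A) g`. -/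

/-- The left factor of `∂_{kα} w` for `w = ŵ g`. -/
noncomputable def partialBaker {𝕜 : Type*} [RCLike 𝕜] {m : ℕ} (ρ : ℝ) (k : ℕ) (α : Fin m)
    (W : Times 𝕜 m → Matrix (Fin m) (Fin m) 𝕜⟦X⟧) (t : Times 𝕜 m) :
    Matrix (Fin m) (Fin m) 𝕜⸨X⸩ :=
  toLaurent (partialW ρ k α W t) + toLaurent (W t) * (zvar 𝕜 ^ k • unitMat 𝕜 α)

/-- `w = ŵ g` is a Baker function of the classical hierarchy on the set `D` of times:
`ŵ = I + O(z⁻¹)`, `L(w) = 0` for some `L = ∂_x - z A + U` with `U` having zero diagonal, where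
`∂_x = ∑ a_α ∂_{1α}`, and `∂_{kα} w = B_{kα} w` for all `k` and `α`. -/
structure IsClassicalBaker {𝕜 : Type*} [RCLike 𝕜] {m : ℕ} (ρ : ℝ) (a : Fin m → 𝕜)
    (D : Set (Times 𝕜 m)) (W : Times 𝕜 m → Matrix (Fin m) (Fin m) 𝕜⟦X⟧) : Prop where
  normalized : ∀ t ∈ D, (W t).map PowerSeries.constantCoeff = 1
  lax : ∃ U : Times 𝕜 m → Matrix (Fin m) (Fin m) 𝕜, ∀ t ∈ D, (∀ i, U t i i = 0) ∧
    ∑ α, a α • partialBaker ρ 1 α W t - zA a * toLaurent (W t)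
      + constMat (U t) * toLaurent (W t) = 0
  flow : ∀ t ∈ D, ∀ k α, partialBaker ρ k α W t = Bmat (W t) k α * toLaurent (W t)

/-- The operator `L_D = Δ - z A + U` on matrix functions on `ℤ`. -/
noncomputable def discL {𝕜 : Type*} [RCLike 𝕜] {m : ℕ} (a : Fin m → 𝕜)
    (U : ℤ → Matrix (Fin m) (Fin m) 𝕜) (F : ℤ → Matrix (Fin m) (Fin m) 𝕜⸨X⸩) (n : ℤ) :
    Matrix (Fin m) (Fin m) 𝕜⸨X⸩ :=
  (F (n + 1) - F n) - zA a * F n + constMat (U n) * F n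

/-- The entrywise partial derivative `∂_{kα} U`. -/
noncomputable def partialU {𝕜 : Type*} [RCLike 𝕜] {m : ℕ} (ρ : ℝ) (k : ℕ) (α : Fin m)
    (U : Times 𝕜 m → Matrix (Fin m) (Fin m) 𝕜) (t : Times 𝕜 m) : Matrix (Fin m) (Fin m) 𝕜 :=
  Matrix.of fun p q => lineDeriv 𝕜 (fun s => U s p q) t (timeDir 𝕜 ρ k α)

/-- `w_D = ŵ_D g` is a Baker function of the discrete hierarchy, where `ŵ_D(n; ·)` is considered
on the set `D n` of times: `ŵ_D = I + O(z⁻¹)`, `∂_{kα} w_D = B_{kα} w_D`, and there is an operator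
`L_D = Δ - z A + U` with
* `L_D ŵ_D = (Λ ŵ_D) (Δ - z A)` as operators (`ŵ_D` is a dressing operator of `L_D`),
* `L_D(w_D) = 0`,
* `∂_{kα} L_D = [B_{kα}, L_D]_D = (Λ B_{kα}) L_D - L_D B_{kα}` as operators.

Operator identities are tested on arbitrary matrix functions `F` on `ℤ`. They are required
wherever both `ŵ_D` and `Λ ŵ_D` are defined. -/
structure IsDiscreteBaker {𝕜 : Type*} [RCLike 𝕜] {m : ℕ} (ρ : ℝ) (a : Fin m → 𝕜)
    (D : ℤ → Set (Times 𝕜 m)) (W : ℤ → Times 𝕜 m → Matrix (Fin m) (Fin m) 𝕜⟦X⟧) : Prop where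
  normalized : ∀ n, ∀ t ∈ D n, (W n t).map PowerSeries.constantCoeff = 1
  flow : ∀ n, ∀ t ∈ D n, ∀ k α,
    partialBaker ρ k α (W n) t = Bmat (W n t) k α * toLaurent (W n t)
  lax : ∃ U : ℤ → Times 𝕜 m → Matrix (Fin m) (Fin m) 𝕜, ∀ n, ∀ t ∈ D n ∩ D (n + 1),
    (∀ F : ℤ → Matrix (Fin m) (Fin m) 𝕜⸨X⸩,
      discL a (fun j => U j t) (fun j => toLaurent (W j t) * F j) n
        = toLaurent (W (n + 1) t) * ((F (n + 1) - F n) - zA a * F n)) ∧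
    (toLaurent (W (n + 1) t) * (1 + zA a) - toLaurent (W n t)) - zA a * toLaurent (W n t)
      + constMat (U n t) * toLaurent (W n t) = 0 ∧
    (∀ k α, ∀ F : ℤ → Matrix (Fin m) (Fin m) 𝕜⸨X⸩,
      constMat (partialU ρ k α (U n) t) * F n
        = Bmat (W (n + 1) t) k α * discL a (fun j => U j t) F n
          - discL a (fun j => U j t) (fun j => Bmat (W j t) k α * F j) n)

/-! ### τ-functions -/

/-- `f(…, t_{kβ} - z⁻ᵏ / k, …)` expanded in powers of `ζ = z⁻¹`: the Taylor series at `ζ = 0`. -/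
noncomputable def satoShift {𝕜 : Type*} [RCLike 𝕜] {m : ℕ} (ρ : ℝ) (β : Fin m)
    (f : Times 𝕜 m → 𝕜) (t : Times 𝕜 m) : 𝕜⟦X⟧ :=
  PowerSeries.mk fun j =>
    iteratedDeriv j (fun ζ : 𝕜 => f (t - satoVec ρ β ζ)) 0 / (j.factorial : 𝕜)

/-- The matrix `ŵ` built from `τ` and the off-diagonal functions `τ_{αβ}`, `α ≠ β` (the values
`τoff α α` are not used):
`ŵ_{αα} = τ(…, t_{kα} - z⁻ᵏ / k, …) / τ(t)` and
`ŵ_{αβ} = z⁻¹ τ_{αβ}(…, t_{kβ} - z⁻ᵏ / k, …) / τ(t)`. -/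
noncomputable def tauDressing {𝕜 : Type*} [RCLike 𝕜] {m : ℕ} (ρ : ℝ) (τ : Times 𝕜 m → 𝕜)
    (τoff : Fin m → Fin m → Times 𝕜 m → 𝕜) (t : Times 𝕜 m) : Matrix (Fin m) (Fin m) 𝕜⟦X⟧ :=
  Matrix.of fun α β =>
    if α = β then (τ t)⁻¹ • satoShift ρ β τ t
    else PowerSeries.X * ((τ t)⁻¹ • satoShift ρ β (τoff α β) t)

/-- `τ`, with its off-diagonal functions `τ_{αβ}`, is an analytic τ-function of the classical
hierarchy on the open set `Ω`: `ŵ` built from it gives a Baker function where `τ ≠ 0`. -/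
structure IsClassicalTau {𝕜 : Type*} [RCLike 𝕜] {m : ℕ} (ρ : ℝ) (a : Fin m → 𝕜)
    (Ω : Set (Times 𝕜 m)) (τ : Times 𝕜 m → 𝕜) (τoff : Fin m → Fin m → Times 𝕜 m → 𝕜) :
    Prop where
  analytic : AnalyticOnNhd 𝕜 τ Ω
  analytic_off : ∀ α β, α ≠ β → AnalyticOnNhd 𝕜 (τoff α β) Ω
  baker : IsClassicalBaker ρ a {t | t ∈ Ω ∧ τ t ≠ 0} (tauDressing ρ τ τoff)

/-- `f_D(n; t) = f(t')` with `t'_{kα} = t_{kα} + n (-1) ^ (k - 1) a_α ^ k / k` for `k ≥ 1` and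
`t'_{0α} = t_{0α}`. -/
noncomputable def discTau {𝕜 : Type*} [RCLike 𝕜] {m : ℕ} (ρ : ℝ) (a : Fin m → 𝕜)
    (f : Times 𝕜 m → 𝕜) (n : ℤ) (t : Times 𝕜 m) : 𝕜 :=
  f (t + n • stepVec ρ a)

end AKNSD

namespace AKNSD

/-! ### Coefficients of matrices of Laurent series -/

section Coefficients

variable {𝕜 : Type*} [RCLike 𝕜] {m : ℕ}

/-- The coefficient of `ζ ^ n = z ^ (-n)` in a matrix of Laurent series. -/
noncomputable def lcoeff (n : ℤ) (F : Matrix (Fin m) (Fin m) 𝕜⸨X⸩) : Matrix (Fin m) (Fin m) 𝕜 :=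
  F.map fun f => f.coeff n

/-- All coefficients of `ζ ^ n` with `n < p` vanish. -/
def OrderGE (p : ℤ) (F : Matrix (Fin m) (Fin m) 𝕜⸨X⸩) : Prop :=
  ∀ n < p, lcoeff n F = 0

@[simp] lemma lcoeff_apply (n : ℤ) (F : Matrix (Fin m) (Fin m) 𝕜⸨X⸩) (i j : Fin m) :
    lcoeff n F i j = (F i j).coeff n := rfl

lemma ext_lcoeff {F G : Matrix (Fin m) (Fin m) 𝕜⸨X⸩} (h : ∀ n, lcoeff n F = lcoeff n G) :
    F = G := by
  ext i j n
  exact congrFun (congrFun (h n) i) j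

@[simp] lemma lcoeff_add (n : ℤ) (F G : Matrix (Fin m) (Fin m) 𝕜⸨X⸩) :
    lcoeff n (F + G) = lcoeff n F + lcoeff n G := by
  ext i j; simp

@[simp] lemma lcoeff_sub (n : ℤ) (F G : Matrix (Fin m) (Fin m) 𝕜⸨X⸩) :
    lcoeff n (F - G) = lcoeff n F - lcoeff n G := by
  ext i j; simp

@[simp] lemma lcoeff_smul (n : ℤ) (c : 𝕜) (F : Matrix (Fin m) (Fin m) 𝕜⸨X⸩) :
    lcoeff n (c • F) = c • lcoeff n F := by
  ext i j; simp

@[simp] lemma lcoeff_sum {ι : Type*} (n : ℤ) (s : Finset ι)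
    (F : ι → Matrix (Fin m) (Fin m) 𝕜⸨X⸩) :
    lcoeff n (∑ i ∈ s, F i) = ∑ i ∈ s, lcoeff n (F i) := by
  ext i j; simp [Matrix.sum_apply]

lemma coeff_mul_eq_sum_Icc {p q : ℤ} {x y : 𝕜⸨X⸩} (hx : ∀ i < p, x.coeff i = 0)
    (hy : ∀ i < q, y.coeff i = 0) (n : ℤ) :
    (x * y).coeff n = ∑ i ∈ Finset.Icc p (n - q), x.coeff i * y.coeff (n - i) := by
  rw [HahnSeries.coeff_mul]
  refine Finset.sum_of_injOn (fun ij => ij.1) ?_ ?_ ?_ ?_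
  · rintro ⟨i, j⟩ h ⟨i', j'⟩ h' (rfl : i = i')
    simp only [Finset.mem_coe, Finset.mem_antidiagonal] at h h'
    simp only [Prod.mk.injEq, true_and]
    omega
  · rintro ⟨i, j⟩ h
    simp only [Finset.mem_coe, Finset.mem_antidiagonal, HahnSeries.mem_support] at h
    simp only [Finset.coe_Icc, Set.mem_Icc]
    have h1 : p ≤ i := by
      by_contra! hc
      exact h.1 (hx i hc)
    have h2 : q ≤ j := by
      by_contra! hc
      exact h.2.1 (hy j hc)
    omega
  · intro i _ hi
    by_contra hc
    refine hi ⟨(i, n - i), ?_, rfl⟩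
    simp only [Finset.mem_coe, Finset.mem_antidiagonal, HahnSeries.mem_support]
    exact ⟨left_ne_zero_of_mul hc, right_ne_zero_of_mul hc, by omega⟩
  · rintro ⟨i, j⟩ h
    simp only [Finset.mem_antidiagonal] at h
    obtain rfl : j = n - i := by omega
    rfl

lemma OrderGE.coeff {p : ℤ} {F : Matrix (Fin m) (Fin m) 𝕜⸨X⸩} (hF : OrderGE p F) (i j : Fin m)
    (n : ℤ) (hn : n < p) : (F i j).coeff n = 0 :=
  congrFun (congrFun (hF n hn) i) j

lemma lcoeff_mul {p q : ℤ} {F G : Matrix (Fin m) (Fin m) 𝕜⸨X⸩} (hF : OrderGE p F)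
    (hG : OrderGE q G) (n : ℤ) :
    lcoeff n (F * G) = ∑ i ∈ Finset.Icc p (n - q), lcoeff i F * lcoeff (n - i) G := by
  ext i j
  simp only [lcoeff_apply, Matrix.mul_apply, Matrix.sum_apply, HahnSeries.coeff_sum]
  rw [Finset.sum_comm]
  exact Finset.sum_congr rfl fun k _ => coeff_mul_eq_sum_Icc (hF.coeff i k) (hG.coeff k j) n

lemma OrderGE.mul {p q : ℤ} {F G : Matrix (Fin m) (Fin m) 𝕜⸨X⸩} (hF : OrderGE p F)
    (hG : OrderGE q G) : OrderGE (p + q) (F * G) := by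
  intro n hn
  rw [lcoeff_mul hF hG, Finset.Icc_eq_empty (by omega), Finset.sum_empty]

lemma OrderGE.add {p : ℤ} {F G : Matrix (Fin m) (Fin m) 𝕜⸨X⸩} (hF : OrderGE p F)
    (hG : OrderGE p G) : OrderGE p (F + G) := by
  intro n hn
  rw [lcoeff_add, hF n hn, hG n hn, add_zero]

lemma OrderGE.mono {p q : ℤ} {F : Matrix (Fin m) (Fin m) 𝕜⸨X⸩} (hF : OrderGE p F) (h : q ≤ p) :
    OrderGE q F :=
  fun n hn => hF n (by omega)

lemma lcoeff_add_mul {p q : ℤ} {F G : Matrix (Fin m) (Fin m) 𝕜⸨X⸩} (hF : OrderGE p F)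
    (hG : OrderGE q G) : lcoeff (p + q) (F * G) = lcoeff p F * lcoeff q G := by
  rw [lcoeff_mul hF hG, add_sub_cancel_right, Finset.Icc_self, Finset.sum_singleton,
    add_sub_cancel_left]

/-- Series with only non-negative powers of `z` are closed under multiplication. -/
lemma lcoeff_mul_eq_zero {p q : ℤ} {F G : Matrix (Fin m) (Fin m) 𝕜⸨X⸩} (hF : OrderGE p F)
    (hG : OrderGE q G) (hF' : ∀ n ≥ 1, lcoeff n F = 0) (hG' : ∀ n ≥ 1, lcoeff n G = 0)
    {n : ℤ} (hn : 1 ≤ n) : lcoeff n (F * G) = 0 := by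
  rw [lcoeff_mul hF hG]
  refine Finset.sum_eq_zero fun i _ => ?_
  rcases le_or_gt 1 i with hi | hi
  · rw [hF' i hi, zero_mul]
  · rw [hG' (n - i) (by omega), mul_zero]

lemma lcoeff_toLaurent (j : ℕ) (W : Matrix (Fin m) (Fin m) 𝕜⟦X⟧) :
    lcoeff j (toLaurent W) = W.map (PowerSeries.coeff j) := by
  ext p q
  simp [toLaurent]

lemma orderGE_toLaurent (W : Matrix (Fin m) (Fin m) 𝕜⟦X⟧) : OrderGE 0 (toLaurent W) := by
  intro n hn
  ext p q
  simp [toLaurent, PowerSeries.coeff_coe, hn]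

lemma lcoeff_constMat (U : Matrix (Fin m) (Fin m) 𝕜) (n : ℤ) :
    lcoeff n (constMat U) = if n = 0 then U else 0 := by
  ext p q
  by_cases h : n = 0 <;> simp [constMat, HahnSeries.C_apply, h]

lemma constMat_one : constMat (1 : Matrix (Fin m) (Fin m) 𝕜) = 1 := by
  simp [constMat]

lemma orderGE_constMat (U : Matrix (Fin m) (Fin m) 𝕜) : OrderGE 0 (constMat U) := by
  intro n hn
  rw [lcoeff_constMat, if_neg (by omega)]

lemma lcoeff_constMat_mul (U : Matrix (Fin m) (Fin m) 𝕜) (F : Matrix (Fin m) (Fin m) 𝕜⸨X⸩)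
    (n : ℤ) : lcoeff n (constMat U * F) = U * lcoeff n F := by
  ext p q
  simp [constMat, Matrix.mul_apply]

lemma lcoeff_mul_constMat (U : Matrix (Fin m) (Fin m) 𝕜) (F : Matrix (Fin m) (Fin m) 𝕜⸨X⸩)
    (n : ℤ) : lcoeff n (F * constMat U) = lcoeff n F * U := by
  ext p q
  simp only [constMat, lcoeff_apply, Matrix.mul_apply, Matrix.map_apply, HahnSeries.coeff_sum]
  refine Finset.sum_congr rfl fun i _ => ?_
  rw [mul_comm, HahnSeries.C_mul_eq_smul, HahnSeries.coeff_smul, smul_eq_mul, mul_comm]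

lemma lcoeff_zvar_smul (F : Matrix (Fin m) (Fin m) 𝕜⸨X⸩) (n : ℤ) :
    lcoeff n (zvar 𝕜 • F) = lcoeff (n + 1) F := by
  ext p q
  simp [zvar, HahnSeries.coeff_single_mul]

lemma lcoeff_zvar_pow_smul (k : ℕ) (F : Matrix (Fin m) (Fin m) 𝕜⸨X⸩) (n : ℤ) :
    lcoeff n (zvar 𝕜 ^ k • F) = lcoeff (n + k) F := by
  induction k generalizing n with
  | zero => simp
  | succ k ih =>
    rw [pow_succ', mul_smul, lcoeff_zvar_smul, ih]
    congr 1
    push_cast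
    ring

lemma lcoeff_mul_zA (a : Fin m → 𝕜) (F : Matrix (Fin m) (Fin m) 𝕜⸨X⸩) (n : ℤ) :
    lcoeff n (F * zA a) = lcoeff (n + 1) F * Matrix.diagonal a := by
  rw [zA, mul_smul_comm, lcoeff_zvar_smul, lcoeff_mul_constMat]

lemma lcoeff_zA (a : Fin m → 𝕜) (n : ℤ) :
    lcoeff n (zA a) = if n = -1 then Matrix.diagonal a else 0 := by
  rw [zA, lcoeff_zvar_smul, lcoeff_constMat]
  exact if_congr (by omega) rfl rfl

lemma lcoeff_one (n : ℤ) :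
    lcoeff n (1 : Matrix (Fin m) (Fin m) 𝕜⸨X⸩) = if n = 0 then 1 else 0 := by
  rw [← constMat_one, lcoeff_constMat]

lemma orderGE_one : OrderGE 0 (1 : Matrix (Fin m) (Fin m) 𝕜⸨X⸩) := by
  rw [← constMat_one]
  exact orderGE_constMat _

lemma orderGE_zA (a : Fin m → 𝕜) : OrderGE (-1) (zA a) := by
  intro n hn
  rw [lcoeff_zA, if_neg (by omega)]

/-! ### Inverses and the matrices `B_{kα}` -/

lemma toLaurent_mul (V W : Matrix (Fin m) (Fin m) 𝕜⟦X⟧) :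
    toLaurent (V * W) = toLaurent V * toLaurent W :=
  Matrix.map_mul

lemma toLaurent_one : toLaurent (1 : Matrix (Fin m) (Fin m) 𝕜⟦X⟧) = 1 := by
  simp [toLaurent]

lemma toLaurent_add (V W : Matrix (Fin m) (Fin m) 𝕜⟦X⟧) :
    toLaurent (V + W) = toLaurent V + toLaurent W := by
  ext1 i j; simp [toLaurent]

lemma isUnit_det_of_normalized {W : Matrix (Fin m) (Fin m) 𝕜⟦X⟧}
    (hW : W.map PowerSeries.constantCoeff = 1) : IsUnit W.det := by
  rw [PowerSeries.isUnit_iff_constantCoeff, RingHom.map_det]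
  change IsUnit (Matrix.det (W.map PowerSeries.constantCoeff))
  rw [hW, Matrix.det_one]
  exact isUnit_one

lemma toLaurent_mul_inv {W : Matrix (Fin m) (Fin m) 𝕜⟦X⟧}
    (hW : W.map PowerSeries.constantCoeff = 1) : toLaurent W * toLaurent W⁻¹ = 1 := by
  rw [← toLaurent_mul, Matrix.mul_nonsing_inv _ (isUnit_det_of_normalized hW), toLaurent_one]

lemma toLaurent_inv_mul {W : Matrix (Fin m) (Fin m) 𝕜⟦X⟧}
    (hW : W.map PowerSeries.constantCoeff = 1) : toLaurent W⁻¹ * toLaurent W = 1 := by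
  rw [← toLaurent_mul, Matrix.nonsing_inv_mul _ (isUnit_det_of_normalized hW), toLaurent_one]

lemma lcoeff_zero_toLaurent {W : Matrix (Fin m) (Fin m) 𝕜⟦X⟧}
    (hW : W.map PowerSeries.constantCoeff = 1) : lcoeff 0 (toLaurent W) = 1 := by
  rw [← hW]
  ext p q
  simp [toLaurent, PowerSeries.coeff_coe]

lemma lcoeff_zero_toLaurent_inv {W : Matrix (Fin m) (Fin m) 𝕜⟦X⟧}
    (hW : W.map PowerSeries.constantCoeff = 1) : lcoeff 0 (toLaurent W⁻¹) = 1 := by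
  have h := lcoeff_add_mul (orderGE_toLaurent W) (orderGE_toLaurent W⁻¹)
  rw [toLaurent_mul_inv hW, add_zero, lcoeff_one, if_pos rfl, lcoeff_zero_toLaurent hW,
    one_mul] at h
  exact h.symm

lemma lcoeff_Bmat (W : Matrix (Fin m) (Fin m) 𝕜⟦X⟧) (k : ℕ) (α : Fin m) (n : ℤ) :
    lcoeff n (Bmat W k α) = if n < 1 then lcoeff (n + k) (resolvent W α) else 0 := by
  rw [← lcoeff_zvar_pow_smul]
  ext p q
  simp only [Bmat, plusPart, lcoeff_apply, Matrix.map_apply, HahnSeries.coeff_truncLT]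
  split_ifs <;> rfl

lemma lcoeff_Bmat_of_one_le (W : Matrix (Fin m) (Fin m) 𝕜⟦X⟧) (k : ℕ) (α : Fin m) (n : ℤ)
    (hn : 1 ≤ n) : lcoeff n (Bmat W k α) = 0 := by
  rw [lcoeff_Bmat, if_neg (by omega)]

lemma unitMat_eq_constMat (α : Fin m) : unitMat 𝕜 α = constMat (Matrix.single α α 1) := by
  ext1 i j
  simp only [unitMat, constMat, Matrix.map_apply, Matrix.single_apply]
  split_ifs <;> simp

lemma orderGE_unitMat (α : Fin m) : OrderGE 0 (unitMat 𝕜 α) := by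
  rw [unitMat_eq_constMat]
  exact orderGE_constMat _

lemma orderGE_resolvent {W : Matrix (Fin m) (Fin m) 𝕜⟦X⟧}
    (hW : W.map PowerSeries.constantCoeff = 1) (α : Fin m) : OrderGE 0 (resolvent W α) := by
  rw [resolvent, Matrix.inv_eq_right_inv (toLaurent_mul_inv hW)]
  exact ((orderGE_toLaurent W).mul (orderGE_unitMat α)).mul (orderGE_toLaurent _)

lemma orderGE_Bmat {W : Matrix (Fin m) (Fin m) 𝕜⟦X⟧}
    (hW : W.map PowerSeries.constantCoeff = 1) (k : ℕ) (α : Fin m) :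
    OrderGE (-k) (Bmat W k α) := by
  intro n hn
  rw [lcoeff_Bmat, if_pos (by omega), orderGE_resolvent hW α _ (by omega)]

end Coefficients

/-! ### Power series with coefficients in a Banach space -/

section BanachSeries

open Filter Topology

variable {𝕜 : Type*} [RCLike 𝕜] {E : Type*} [NormedAddCommGroup E] [NormedSpace 𝕜 E]
  [CompleteSpace E]

lemma summable_pow_smul {v : ℕ → E} {C r : ℝ} (hv : ∀ k, ‖v k‖ ≤ C * r ^ k) {e : 𝕜} (hr : 0 ≤ r)
    (he : ‖e‖ * r < 1) : Summable fun k => e ^ k • v k := by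
  refine Summable.of_norm_bounded
    ((summable_geometric_of_lt_one (mul_nonneg (norm_nonneg e) hr) he).mul_left C) fun k => ?_
  rw [norm_smul, norm_pow, mul_pow]
  calc ‖e‖ ^ k * ‖v k‖ ≤ ‖e‖ ^ k * (C * r ^ k) := by gcongr; exact hv k
    _ = C * (‖e‖ ^ k * r ^ k) := by ring

lemma analyticAt_tsum_pow_smul {v : ℕ → E} {C r : ℝ} (hr : 0 < r) (hv : ∀ k, ‖v k‖ ≤ C * r ^ k)
    {e : 𝕜} (he : ‖e‖ * r < 1) : AnalyticAt 𝕜 (fun x : 𝕜 => ∑' k, x ^ k • v k) e := by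
  let p : FormalMultilinearSeries 𝕜 𝕜 E := fun k => ContinuousMultilinearMap.mkPiRing 𝕜 (Fin k) (v k)
  obtain ⟨R, hR⟩ : ∃ R : NNReal, (R : ℝ) = r⁻¹ := ⟨⟨r⁻¹, by positivity⟩, rfl⟩
  have hp : (R : ENNReal) ≤ p.radius := by
    refine p.le_radius_of_bound C fun k => ?_
    simp only [p, ContinuousMultilinearMap.norm_mkPiRing, hR]
    calc ‖v k‖ * r⁻¹ ^ k ≤ C * r ^ k * r⁻¹ ^ k := by gcongr; exact hv k
      _ = C := by rw [mul_assoc, ← mul_pow, mul_inv_cancel₀ hr.ne', one_pow, mul_one]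
  have hpos : 0 < p.radius := by
    refine lt_of_lt_of_le ?_ hp
    rw [ENNReal.coe_pos, ← NNReal.coe_pos, hR]
    positivity
  have hsum : p.sum = fun x : 𝕜 => ∑' k, x ^ k • v k := by
    funext x
    simp [FormalMultilinearSeries.sum, p]
  rw [← hsum]
  refine (p.hasFPowerSeriesOnBall hpos).analyticOnNhd e ?_
  refine Metric.eball_subset_eball hp ?_
  rwa [Metric.eball_coe, Metric.mem_ball, dist_zero_right, hR, ← one_div, lt_div_iff₀ hr]

lemma exists_hasDerivAt_tsum_pow_smul {v : ℕ → E} {C r : ℝ} (hr : 0 < r)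
    (hv : ∀ k, ‖v k‖ ≤ C * r ^ k) (N : ℕ) :
    ∃ R : 𝕜 → E, ContinuousAt R 0 ∧ ∀ᶠ e in 𝓝 (0 : 𝕜),
      HasDerivAt (fun x : 𝕜 => ∑' k, x ^ k • v k)
        (∑ k ∈ Finset.range N, (((k + 1 : ℕ) : 𝕜) * e ^ k) • v (k + 1) + e ^ N • R e) e := by
  let g : 𝕜 → E := fun x => ∑' k, x ^ k • v (k + (N + 1))
  have hg : AnalyticAt 𝕜 g 0 := by
    refine analyticAt_tsum_pow_smul (C := C * r ^ (N + 1)) hr (fun k => (hv _).trans_eq ?_) (by simp)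
    rw [pow_add]
    ring
  have hnear : ∀ᶠ e in 𝓝 (0 : 𝕜), ‖e‖ * r < 1 :=
    (continuous_norm.mul continuous_const).continuousAt.eventually_lt continuousAt_const (by simp)
  have hsplit : ∀ᶠ e in 𝓝 (0 : 𝕜), ∑' k, e ^ k • v k
      = ∑ k ∈ Finset.range (N + 1), e ^ k • v k + e ^ (N + 1) • g e := by
    filter_upwards [hnear] with e he
    rw [← (summable_pow_smul hv hr.le he).sum_add_tsum_nat_add (N + 1)]
    congr 1
    have hs : Summable fun k => e ^ k • v (k + (N + 1)) :=
      summable_pow_smul (C := C * r ^ (N + 1))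
        (fun k => (hv _).trans_eq (by rw [pow_add]; ring)) hr.le he
    simp only [g]
    rw [← hs.tsum_const_smul (e ^ (N + 1))]
    refine tsum_congr fun k => ?_
    rw [smul_smul, ← pow_add, add_comm]
  refine ⟨fun e => ((N + 1 : ℕ) : 𝕜) • g e + e • deriv g e, ?_, ?_⟩
  · exact (hg.continuousAt.const_smul _).add (continuousAt_id.smul hg.deriv.continuousAt)
  · filter_upwards [hsplit.eventually_nhds, hg.eventually_analyticAt] with e he hge
    refine HasDerivAt.congr_of_eventuallyEq ?_ he
    have h1 : HasDerivAt (fun x : 𝕜 => ∑ k ∈ Finset.range (N + 1), x ^ k • v k)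
        (∑ k ∈ Finset.range (N + 1), ((k : 𝕜) * e ^ (k - 1)) • v k) e :=
      HasDerivAt.fun_sum fun k _ => (hasDerivAt_pow k e).smul_const (v k)
    have h2 := (hasDerivAt_pow (N + 1) e).smul hge.differentiableAt.hasDerivAt
    refine (h1.add h2).congr_deriv ?_
    rw [Finset.sum_range_succ']
    simp only [Nat.cast_zero, zero_mul, zero_smul, add_zero, add_tsub_cancel_right, smul_add,
      smul_smul]
    rw [← pow_succ, mul_comm (e ^ N), add_comm (e ^ (N + 1) • _)]

end BanachSeries

/-! ### The shifts as analytic functions of their parameter -/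

section Shifts

open Filter Topology

variable {𝕜 : Type*} [RCLike 𝕜] {m : ℕ}

lemma ofTimes_eq {ρ : ℝ} {t : ℕ × Fin m → 𝕜} {x : Times 𝕜 m}
    (hx : ∀ i, x i = (ρ : 𝕜) ^ i.1 * t i) : ofTimes ρ t = x := by
  have h : (fun i : ℕ × Fin m => (ρ : 𝕜) ^ i.1 * t i) = x := funext fun i => (hx i).symm
  rw [ofTimes, dif_pos (by rw [h]; exact lp.memℓp x)]
  exact Subtype.ext h

lemma timeDir_eq_single (ρ : ℝ) (k : ℕ) (α : Fin m) :
    timeDir 𝕜 ρ k α = lp.single 1 (k, α) ((ρ : 𝕜) ^ k) := by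
  refine ofTimes_eq fun i => ?_
  rw [lp.single_apply]
  by_cases h : i = (k, α)
  · subst h; simp
  · simp [h]

lemma norm_sum_timeDir_le {ρ r : ℝ} (hρ : 0 < ρ) {c : ℕ × Fin m → 𝕜}
    (hc : ∀ i, ρ ^ i.1 * ‖c i‖ ≤ r ^ i.1) (k : ℕ) :
    ‖∑ α, c (k, α) • timeDir 𝕜 ρ k α‖ ≤ m * r ^ k := by
  calc ‖∑ α, c (k, α) • timeDir 𝕜 ρ k α‖ ≤ ∑ α : Fin m, r ^ k := by
        refine norm_sum_le_of_le _ fun α _ => ?_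
        rw [norm_smul, timeDir_eq_single, lp.norm_single (by norm_num), norm_pow,
          RCLike.norm_ofReal, abs_of_pos hρ, mul_comm]
        exact hc (k, α)
    _ = m * r ^ k := by simp

lemma ofTimes_pow_mul_eq_tsum {ρ r : ℝ} (hρ : 0 < ρ) (hr : 0 < r) {c : ℕ × Fin m → 𝕜}
    (hc : ∀ i, ρ ^ i.1 * ‖c i‖ ≤ r ^ i.1) {e : 𝕜} (he : ‖e‖ * r < 1) :
    ofTimes ρ (fun i => e ^ i.1 * c i)
      = ∑' k, e ^ k • ∑ α, c (k, α) • timeDir 𝕜 ρ k α := by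
  refine ofTimes_eq fun i => ?_
  have hs := summable_pow_smul (norm_sum_timeDir_le hρ hc) hr.le he
  have h := (lp.evalCLM 𝕜 (fun _ : ℕ × Fin m => 𝕜) 1 i).map_tsum hs
  change (∑' k, e ^ k • ∑ α, c (k, α) • timeDir 𝕜 ρ k α : Times 𝕜 m) i = _ at h
  rw [h, tsum_eq_single i.1]
  · change (e ^ i.1 • ∑ α, c (i.1, α) • timeDir 𝕜 ρ i.1 α : Times 𝕜 m) i = _
    simp only [lp.coeFn_smul, lp.coeFn_sum, Pi.smul_apply, Finset.sum_apply, timeDir_eq_single,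
      lp.single_apply]
    rw [Finset.sum_eq_single i.2]
    · simp
      ring
    · intro α _ hα
      rw [Pi.single_eq_of_ne (fun h => hα (by rw [h])), smul_zero]
    · simp
  · intro k hk
    change (e ^ k • ∑ α, c (k, α) • timeDir 𝕜 ρ k α : Times 𝕜 m) i = _
    simp only [lp.coeFn_smul, lp.coeFn_sum, Pi.smul_apply, Finset.sum_apply, timeDir_eq_single,
      lp.single_apply]
    rw [Finset.sum_eq_zero, smul_zero]
    intro α _
    rw [Pi.single_eq_of_ne (fun h => hk (by rw [h])), smul_zero]

lemma norm_natCast_inv_le_one (k : ℕ) : ‖((k : 𝕜))⁻¹‖ ≤ 1 := by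
  rw [norm_inv, RCLike.norm_natCast]
  rcases Nat.eq_zero_or_pos k with rfl | hk
  · simp
  · exact inv_le_one_of_one_le₀ (by exact_mod_cast hk)

lemma analyticAt_satoVec {ρ : ℝ} (hρ : 0 < ρ) (β : Fin m) :
    AnalyticAt 𝕜 (satoVec ρ β : 𝕜 → Times 𝕜 m) 0 := by
  let c : ℕ × Fin m → 𝕜 := fun i => if 1 ≤ i.1 ∧ i.2 = β then ((i.1 : 𝕜))⁻¹ else 0
  have hc : ∀ i, ρ ^ i.1 * ‖c i‖ ≤ ρ ^ i.1 := fun i => by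
    refine mul_le_of_le_one_right (by positivity) ?_
    simp only [c]
    split_ifs
    · exact norm_natCast_inv_le_one _
    · simp
  have hnear : ∀ᶠ e in 𝓝 (0 : 𝕜), ‖e‖ * ρ < 1 :=
    (continuous_norm.mul continuous_const).continuousAt.eventually_lt continuousAt_const (by simp)
  refine (analyticAt_tsum_pow_smul hρ (norm_sum_timeDir_le hρ hc) (e := (0 : 𝕜)) (by simp)).congr ?_
  filter_upwards [hnear] with e he
  rw [← ofTimes_pow_mul_eq_tsum hρ hρ hc he, satoVec]
  congr 1
  funext i
  simp only [c]
  split_ifs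
  · rw [div_eq_mul_inv]
  · rw [mul_zero]

lemma satoVec_zero (ρ : ℝ) (β : Fin m) : satoVec ρ β (0 : 𝕜) = 0 := by
  refine ofTimes_eq fun i => ?_
  split_ifs with h
  · simp [show i.1 ≠ 0 by omega]
  · simp

lemma stepVec_zero (ρ : ℝ) : stepVec ρ (fun _ : Fin m => (0 : 𝕜)) = 0 := by
  refine ofTimes_eq fun i => ?_
  split_ifs with h
  · simp [show i.1 ≠ 0 by omega]
  · simp

/-- The coefficients of the expansion of the discrete shift in powers of its scaling parameter. -/
noncomputable def stepCoeff (a : Fin m → 𝕜) (i : ℕ × Fin m) : 𝕜 :=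
  if 1 ≤ i.1 then (-1) ^ (i.1 - 1) * a i.2 ^ i.1 / (i.1 : 𝕜) else 0

lemma stepVec_mul (ρ : ℝ) (a : Fin m → 𝕜) (e : 𝕜) :
    stepVec ρ (fun α => e * a α) = ofTimes ρ fun i => e ^ i.1 * stepCoeff a i := by
  rw [stepVec]
  congr 1
  funext i
  simp only [stepCoeff]
  split_ifs
  · ring
  · rw [mul_zero]

lemma exists_stepCoeff_bound {a : Fin m → 𝕜} {ρ : ℝ} (hρ : 0 < ρ) (ha : ∀ α, ρ * ‖a α‖ < 1) :
    ∃ r, 0 < r ∧ r < 1 ∧ ∀ i, ρ ^ i.1 * ‖stepCoeff a i‖ ≤ r ^ i.1 := by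
  obtain ⟨r, hr0, hr1, hr⟩ : ∃ r : ℝ, 0 < r ∧ r < 1 ∧ ∀ α, ρ * ‖a α‖ ≤ r := by
    have h : ∀ᶠ r in 𝓝[<] (1 : ℝ), 0 < r ∧ r < 1 ∧ ∀ α, ρ * ‖a α‖ ≤ r := by
      have h1 : ∀ᶠ r in 𝓝[<] (1 : ℝ), r < 1 := eventually_mem_nhdsWithin
      have h2 : ∀ᶠ r in 𝓝[<] (1 : ℝ), ∀ α, ρ * ‖a α‖ < r :=
        eventually_all.2 fun α => eventually_nhdsWithin_of_eventually_nhds (lt_mem_nhds (ha α))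
      have h0 : ∀ᶠ r in 𝓝[<] (1 : ℝ), 0 < r :=
        eventually_nhdsWithin_of_eventually_nhds (lt_mem_nhds one_pos)
      filter_upwards [h0, h1, h2] with r h0 h1 h2
      exact ⟨h0, h1, fun α => (h2 α).le⟩
    exact h.exists
  refine ⟨r, hr0, hr1, fun i => ?_⟩
  rw [stepCoeff]
  split_ifs
  · rw [div_eq_mul_inv, norm_mul, norm_mul, norm_pow, norm_neg, norm_one, one_pow, one_mul,
      norm_pow, ← mul_assoc, ← mul_pow]
    refine (mul_le_of_le_one_right (by positivity) (norm_natCast_inv_le_one _)).trans ?_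
    exact pow_le_pow_left₀ (by positivity) (hr i.2) _
  · rw [norm_zero, mul_zero]
    positivity

lemma analyticAt_stepVec {a : Fin m → 𝕜} {ρ : ℝ} (hρ : 0 < ρ) (ha : ∀ α, ρ * ‖a α‖ < 1)
    {e : 𝕜} (he : ‖e‖ ≤ 1) : AnalyticAt 𝕜 (fun x : 𝕜 => stepVec ρ fun α => x * a α) e := by
  obtain ⟨r, hr0, hr1, hc⟩ := exists_stepCoeff_bound hρ ha
  have her : ‖e‖ * r < 1 := by nlinarith [norm_nonneg e]
  have hnear : ∀ᶠ x in 𝓝 e, ‖x‖ * r < 1 :=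
    (continuous_norm.mul continuous_const).continuousAt.eventually_lt continuousAt_const her
  refine (analyticAt_tsum_pow_smul hr0 (norm_sum_timeDir_le hρ hc) her).congr ?_
  filter_upwards [hnear] with x hx
  rw [← ofTimes_pow_mul_eq_tsum hρ hr0 hc hx, stepVec_mul]

/-- The derivative of the discrete shift, expanded to a given order in the scaling parameter. -/
lemma exists_hasDerivAt_stepVec {a : Fin m → 𝕜} {ρ : ℝ} (hρ : 0 < ρ)
    (ha : ∀ α, ρ * ‖a α‖ < 1) (N : ℕ) :
    ∃ R : 𝕜 → Times 𝕜 m, ContinuousAt R 0 ∧ ∀ᶠ e in 𝓝 (0 : 𝕜),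
      HasDerivAt (fun x : 𝕜 => stepVec ρ fun α => x * a α)
        (∑ k ∈ Finset.range N, ∑ α, ((-e) ^ k * a α ^ (k + 1)) • timeDir 𝕜 ρ (k + 1) α
          + e ^ N • R e) e := by
  obtain ⟨r, hr0, -, hc⟩ := exists_stepCoeff_bound hρ ha
  obtain ⟨R, hR, h⟩ :=
    exists_hasDerivAt_tsum_pow_smul (𝕜 := 𝕜) hr0 (norm_sum_timeDir_le hρ hc) N
  have hnear : ∀ᶠ x in 𝓝 (0 : 𝕜), ‖x‖ * r < 1 :=
    (continuous_norm.mul continuous_const).continuousAt.eventually_lt continuousAt_const (by simp)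
  refine ⟨R, hR, ?_⟩
  filter_upwards [h, hnear.eventually_nhds] with e he hne
  refine (he.congr_of_eventuallyEq ?_).congr_deriv ?_
  · filter_upwards [hne] with x hx
    rw [← ofTimes_pow_mul_eq_tsum hρ hr0 hc hx, stepVec_mul]
  · congr 1
    refine Finset.sum_congr rfl fun k _ => ?_
    rw [Finset.smul_sum]
    refine Finset.sum_congr rfl fun α _ => ?_
    rw [smul_smul]
    congr 1
    have hk : ((k + 1 : ℕ) : 𝕜) ≠ 0 := Nat.cast_ne_zero.2 k.succ_ne_zero
    simp only [stepCoeff, le_add_iff_nonneg_left, zero_le, if_true, add_tsub_cancel_right]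
    rw [neg_pow e]
    field_simp

end Shifts

/-! ### Analyticity of the dressing matrix -/

section Dressing

open Filter Topology

variable {𝕜 : Type*} [RCLike 𝕜] {m : ℕ}

lemma analyticAt_iteratedDeriv_snd {E : Type*} [NormedAddCommGroup E] [NormedSpace 𝕜 E]
    {F : E × 𝕜 → 𝕜} {x₀ : E × 𝕜} (hF : AnalyticAt 𝕜 F x₀) (j : ℕ) :
    AnalyticAt 𝕜 (fun x : E × 𝕜 => iteratedDeriv j (fun ζ => F (x.1, ζ)) x.2) x₀ := by
  induction j with
  | zero => simpa using hF
  | succ j ih =>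
    let G : E × 𝕜 → 𝕜 := fun x => iteratedDeriv j (fun ζ => F (x.1, ζ)) x.2
    have hG : AnalyticAt 𝕜 (fun x => fderiv 𝕜 G x (0, 1)) x₀ :=
      ((ContinuousLinearMap.apply 𝕜 𝕜 ((0, 1) : E × 𝕜)).analyticAt _).comp
        (AnalyticAt.fderiv (f := G) ih)
    refine hG.congr ?_
    filter_upwards [AnalyticAt.eventually_analyticAt (f := G) ih] with x hx
    rw [iteratedDeriv_succ]
    have h1 : HasDerivAt (fun ζ : 𝕜 => (x.1, ζ)) ((0, 1) : E × 𝕜) x.2 :=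
      (hasDerivAt_const x.2 x.1).prodMk (hasDerivAt_id x.2)
    have h2 : HasFDerivAt G (fderiv 𝕜 G x) (x.1, x.2) := hx.differentiableAt.hasFDerivAt
    exact (h2.comp_hasDerivAt x.2 h1).deriv.symm

lemma analyticAt_coeff_satoShift {ρ : ℝ} (hρ : 0 < ρ) (β : Fin m) {f : Times 𝕜 m → 𝕜}
    {t : Times 𝕜 m} (hf : AnalyticAt 𝕜 f t) (j : ℕ) :
    AnalyticAt 𝕜 (fun s => PowerSeries.coeff j (satoShift ρ β f s)) t := by
  have hF : AnalyticAt 𝕜 (fun x : Times 𝕜 m × 𝕜 => f (x.1 - satoVec ρ β x.2)) (t, 0) := by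
    refine AnalyticAt.comp (f := fun x : Times 𝕜 m × 𝕜 => x.1 - satoVec ρ β x.2) ?_ ?_
    · simpa [satoVec_zero] using hf
    · exact analyticAt_fst.sub ((analyticAt_satoVec hρ β).comp_of_eq analyticAt_snd rfl)
  have h := (analyticAt_iteratedDeriv_snd hF j).comp_of_eq
    (g := fun x : Times 𝕜 m × 𝕜 =>
      iteratedDeriv j (fun ζ => f (x.1 - satoVec ρ β ζ)) x.2)
    (f := fun s : Times 𝕜 m => (s, (0 : 𝕜))) (analyticAt_id.prod analyticAt_const) rfl
  simp only [satoShift, PowerSeries.coeff_mk]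
  exact h.div_const

/-- The numerator `τ ŵ` of the dressing matrix. -/
noncomputable def tauNum (ρ : ℝ) (τ : Times 𝕜 m → 𝕜) (τoff : Fin m → Fin m → Times 𝕜 m → 𝕜)
    (t : Times 𝕜 m) : Matrix (Fin m) (Fin m) 𝕜⟦X⟧ :=
  Matrix.of fun α β =>
    if α = β then satoShift ρ β τ t else PowerSeries.X * satoShift ρ β (τoff α β) t

lemma tauDressing_eq_smul (ρ : ℝ) (τ : Times 𝕜 m → 𝕜) (τoff : Fin m → Fin m → Times 𝕜 m → 𝕜)
    (t : Times 𝕜 m) : tauDressing ρ τ τoff t = (τ t)⁻¹ • tauNum ρ τ τoff t := by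
  ext1 α β
  simp only [tauDressing, tauNum, Matrix.of_apply, Matrix.smul_apply]
  split_ifs
  · rfl
  · rw [mul_smul_comm]

lemma analyticAt_coeff_tauNum {ρ : ℝ} (hρ : 0 < ρ) {τ : Times 𝕜 m → 𝕜}
    {τoff : Fin m → Fin m → Times 𝕜 m → 𝕜} {t : Times 𝕜 m} (hτ : AnalyticAt 𝕜 τ t)
    (hoff : ∀ α β, α ≠ β → AnalyticAt 𝕜 (τoff α β) t) (j : ℕ) (p q : Fin m) :
    AnalyticAt 𝕜 (fun s => PowerSeries.coeff j (tauNum ρ τ τoff s p q)) t := by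
  simp only [tauNum, Matrix.of_apply]
  split_ifs with h
  · exact analyticAt_coeff_satoShift hρ q hτ j
  · cases j with
    | zero => simpa using analyticAt_const
    | succ j =>
      simp only [PowerSeries.coeff_succ_X_mul]
      exact analyticAt_coeff_satoShift hρ q (hoff p q h) j

lemma analyticAt_coeff_tauDressing {ρ : ℝ} (hρ : 0 < ρ) {τ : Times 𝕜 m → 𝕜}
    {τoff : Fin m → Fin m → Times 𝕜 m → 𝕜} {t : Times 𝕜 m} (hτ : AnalyticAt 𝕜 τ t)
    (hoff : ∀ α β, α ≠ β → AnalyticAt 𝕜 (τoff α β) t) (h0 : τ t ≠ 0) (j : ℕ) (p q : Fin m) :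
    AnalyticAt 𝕜 (fun s => PowerSeries.coeff j (tauDressing ρ τ τoff s p q)) t := by
  simp only [tauDressing_eq_smul, Matrix.smul_apply, map_smul, smul_eq_mul]
  exact (hτ.inv h0).mul (analyticAt_coeff_tauNum hρ hτ hoff j p q)

/-! ### Translations of the times -/

lemma satoShift_translate (ρ : ℝ) (β : Fin m) (f : Times 𝕜 m → 𝕜) (v t : Times 𝕜 m) :
    satoShift ρ β (fun s => f (s + v)) t = satoShift ρ β f (t + v) := by
  simp only [satoShift, sub_add_eq_add_sub]

lemma tauDressing_discTau (ρ : ℝ) (a : Fin m → 𝕜) (τ : Times 𝕜 m → 𝕜)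
    (τoff : Fin m → Fin m → Times 𝕜 m → 𝕜) (n : ℤ) (t : Times 𝕜 m) :
    tauDressing ρ (discTau ρ a τ n) (fun α β => discTau ρ a (τoff α β) n) t
      = tauDressing ρ τ τoff (t + n • stepVec ρ a) := by
  ext1 α β
  simp only [tauDressing, Matrix.of_apply]
  have h : ∀ f : Times 𝕜 m → 𝕜, satoShift ρ β (discTau ρ a f n) t
      = satoShift ρ β f (t + n • stepVec ρ a) := fun f => satoShift_translate ρ β f _ t
  rw [h, h, discTau]

lemma partialW_translate (ρ : ℝ) (k : ℕ) (α : Fin m)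
    (W : Times 𝕜 m → Matrix (Fin m) (Fin m) 𝕜⟦X⟧) (v t : Times 𝕜 m) :
    partialW ρ k α (fun s => W (s + v)) t = partialW ρ k α W (t + v) := by
  simp only [partialW, lineDeriv, add_right_comm t _ v]

lemma partialBaker_translate (ρ : ℝ) (k : ℕ) (α : Fin m)
    (W : Times 𝕜 m → Matrix (Fin m) (Fin m) 𝕜⟦X⟧) (v t : Times 𝕜 m) :
    partialBaker ρ k α (fun s => W (s + v)) t = partialBaker ρ k α W (t + v) := by
  rw [partialBaker, partialBaker, partialW_translate]

end Dressing

/-! ### Families of matrices of series depending on a scalar parameter -/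

section Families

open Filter Topology Asymptotics

variable {𝕜 : Type*} [RCLike 𝕜] {m : ℕ}

lemma coeff_toLaurent_mul {d : ℤ} {C : Matrix (Fin m) (Fin m) 𝕜⸨X⸩} (hC : OrderGE d C)
    (P : Matrix (Fin m) (Fin m) 𝕜⟦X⟧) (n : ℤ) (p q : Fin m) :
    lcoeff n (toLaurent P * C) p q = ∑ i ∈ Finset.Icc 0 (n - d), ∑ r,
      PowerSeries.coeff i.toNat (P p r) * (C r q).coeff (n - i) := by
  rw [lcoeff_mul (orderGE_toLaurent P) hC, Matrix.sum_apply]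
  refine Finset.sum_congr rfl fun i hi => ?_
  obtain ⟨j, rfl⟩ := Int.eq_ofNat_of_zero_le (Finset.mem_Icc.1 hi).1
  rw [Matrix.mul_apply, lcoeff_toLaurent]
  rfl

lemma analyticAt_lcoeff_toLaurent_mul {P : 𝕜 → Matrix (Fin m) (Fin m) 𝕜⟦X⟧} {e₀ : 𝕜}
    (hP : ∀ j p q, AnalyticAt 𝕜 (fun e => PowerSeries.coeff j (P e p q)) e₀) {d : ℤ}
    {C : Matrix (Fin m) (Fin m) 𝕜⸨X⸩} (hC : OrderGE d C) (n : ℤ) (p q : Fin m) :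
    AnalyticAt 𝕜 (fun e => lcoeff n (toLaurent (P e) * C) p q) e₀ := by
  simp only [coeff_toLaurent_mul hC]
  exact Finset.analyticAt_fun_sum _ fun i _ => Finset.analyticAt_fun_sum _ fun r _ =>
    (hP _ _ _).mul analyticAt_const

lemma hasDerivAt_lcoeff_toLaurent_mul {P : 𝕜 → Matrix (Fin m) (Fin m) 𝕜⟦X⟧} {e₀ : 𝕜}
    {V : Matrix (Fin m) (Fin m) 𝕜⟦X⟧}
    (hP : ∀ j p q, HasDerivAt (fun e => PowerSeries.coeff j (P e p q))
      (PowerSeries.coeff j (V p q)) e₀) {d : ℤ}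
    {C : Matrix (Fin m) (Fin m) 𝕜⸨X⸩} (hC : OrderGE d C) (n : ℤ) (p q : Fin m) :
    HasDerivAt (fun e => lcoeff n (toLaurent (P e) * C) p q) (lcoeff n (toLaurent V * C) p q)
      e₀ := by
  simp only [coeff_toLaurent_mul hC]
  exact HasDerivAt.fun_sum fun i _ => HasDerivAt.fun_sum fun r _ => (hP _ _ _).mul_const _

/-- Entrywise domination of a matrix function near `0`. -/
def MatBigO (F : 𝕜 → Matrix (Fin m) (Fin m) 𝕜) (g : 𝕜 → ℝ) : Prop :=
  ∀ p q, (fun e => F e p q) =O[𝓝 0] g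

lemma MatBigO.add {F G : 𝕜 → Matrix (Fin m) (Fin m) 𝕜} {g : 𝕜 → ℝ} (hF : MatBigO F g)
    (hG : MatBigO G g) : MatBigO (fun e => F e + G e) g :=
  fun p q => (hF p q).add (hG p q)

lemma MatBigO.sub {F G : 𝕜 → Matrix (Fin m) (Fin m) 𝕜} {g : 𝕜 → ℝ} (hF : MatBigO F g)
    (hG : MatBigO G g) : MatBigO (fun e => F e - G e) g :=
  fun p q => (hF p q).sub (hG p q)

lemma MatBigO.sum {ι : Type*} {s : Finset ι} {F : ι → 𝕜 → Matrix (Fin m) (Fin m) 𝕜} {g : 𝕜 → ℝ}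
    (hF : ∀ i ∈ s, MatBigO (F i) g) : MatBigO (fun e => ∑ i ∈ s, F i e) g := fun p q => by
  simp only [Matrix.sum_apply]
  exact IsBigO.fun_sum fun i hi => hF i hi p q

lemma MatBigO.mul {F G : 𝕜 → Matrix (Fin m) (Fin m) 𝕜} {f g : 𝕜 → ℝ} (hF : MatBigO F f)
    (hG : MatBigO G g) : MatBigO (fun e => F e * G e) fun e => f e * g e := fun p q => by
  simp only [Matrix.mul_apply]
  exact IsBigO.fun_sum fun r _ => (hF p r).mul (hG r q)

lemma MatBigO.smul {c : 𝕜 → 𝕜} {G : 𝕜 → Matrix (Fin m) (Fin m) 𝕜} {f g : 𝕜 → ℝ}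
    (hc : c =O[𝓝 0] f) (hG : MatBigO G g) : MatBigO (fun e => c e • G e) fun e => f e * g e :=
  fun p q => hc.mul (hG p q)

lemma MatBigO.congr' {F G : 𝕜 → Matrix (Fin m) (Fin m) 𝕜} {g : 𝕜 → ℝ} (hF : MatBigO F g)
    (h : ∀ᶠ e in 𝓝 0, F e = G e) : MatBigO G g := fun p q =>
  (hF p q).congr' (h.mono fun _ he => congrFun (congrFun he p) q) EventuallyEq.rfl

lemma MatBigO.of_eventually_zero {F : 𝕜 → Matrix (Fin m) (Fin m) 𝕜} {g : 𝕜 → ℝ}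
    (h : ∀ᶠ e in 𝓝 0, F e = 0) : MatBigO F g := fun p q =>
  (isBigO_zero g (𝓝 0)).congr'
    (h.mono fun e he => by simp [he]) EventuallyEq.rfl

lemma matBigO_lcoeff_toLaurent_mul {P : 𝕜 → Matrix (Fin m) (Fin m) 𝕜⟦X⟧} {g : 𝕜 → ℝ}
    (hP : ∀ j p q, (fun e => PowerSeries.coeff j (P e p q)) =O[𝓝 0] g) {d : ℤ}
    {C : Matrix (Fin m) (Fin m) 𝕜⸨X⸩} (hC : OrderGE d C) (n : ℤ) :
    MatBigO (fun e => lcoeff n (toLaurent (P e) * C)) g := fun p q => by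
  simp only [coeff_toLaurent_mul hC]
  refine IsBigO.fun_sum fun i _ => IsBigO.fun_sum fun r _ => ?_
  simpa only [mul_comm] using (hP i.toNat p r).const_mul_left ((C r q).coeff (n - i))

/-- If `F ŵ` has bounded coefficients for normalized `ŵ` with bounded coefficients, then so
does `F`. -/
lemma matBigO_lcoeff_of_mul {F : 𝕜 → Matrix (Fin m) (Fin m) 𝕜⸨X⸩}
    {W : 𝕜 → Matrix (Fin m) (Fin m) 𝕜⟦X⟧} {d : ℤ} (hF : ∀ᶠ e in 𝓝 0, OrderGE d (F e))
    (hW : ∀ᶠ e in 𝓝 0, (W e).map PowerSeries.constantCoeff = 1)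
    (hWb : ∀ n, MatBigO (fun e => lcoeff n (toLaurent (W e))) fun _ => 1)
    (hFW : ∀ n, MatBigO (fun e => lcoeff n (F e * toLaurent (W e))) fun _ => 1) (n : ℤ) :
    MatBigO (fun e => lcoeff n (F e)) fun _ => 1 := by
  suffices h : ∀ j : ℕ, ∀ i < d + j, MatBigO (fun e => lcoeff i (F e)) fun _ => 1 from
    h (n - d + 1).toNat n (by omega)
  intro j
  induction j with
  | zero =>
    intro i hi
    exact MatBigO.of_eventually_zero (hF.mono fun e he => he i (by omega))
  | succ j ih =>
    intro i hi
    rcases lt_or_ge i (d + j) with hlt | hge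
    · exact ih i hlt
    have hb : MatBigO (fun e => lcoeff i (F e * toLaurent (W e))
        - ∑ l ∈ Finset.Ico d i, lcoeff l (F e) * lcoeff (i - l) (toLaurent (W e))) fun _ => 1 := by
      refine (hFW i).sub (MatBigO.sum fun l hl => ?_)
      have := (ih l (by have := (Finset.mem_Ico.1 hl).2; push_cast at hi; omega)).mul (hWb (i - l))
      simpa using this
    refine hb.congr' ?_
    filter_upwards [hF, hW] with e hFe hWe
    rw [lcoeff_mul hFe (orderGE_toLaurent _), sub_zero, ← Finset.Ico_insert_right (by omega),
      Finset.sum_insert (by simp), sub_self, lcoeff_zero_toLaurent hWe, mul_one,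
      add_sub_cancel_right]

/-! ### Vanishing to all orders -/

lemma isBigO_pow_succ_of_deriv {f f' : 𝕜 → 𝕜} (hf : ∀ᶠ e in 𝓝 0, HasDerivAt f (f' e) e)
    (h0 : f 0 = 0) {j : ℕ} (hf' : f' =O[𝓝 0] fun e => ‖e‖ ^ j) :
    f =O[𝓝 0] fun e => ‖e‖ ^ (j + 1) := by
  obtain ⟨C, hC⟩ := hf'.bound
  obtain ⟨δ, hδ, h⟩ := Metric.eventually_nhds_iff_ball.1 (hf.and hC)
  refine IsBigO.of_bound C ?_
  filter_upwards [Metric.ball_mem_nhds (0 : 𝕜) hδ] with e he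
  have hsub : Metric.closedBall (0 : 𝕜) ‖e‖ ⊆ Metric.ball 0 δ :=
    Metric.closedBall_subset_ball (by simpa using he)
  have hC0 : 0 ≤ C ∨ ‖e‖ ^ j = 0 := by
    by_contra! hc
    have := (norm_nonneg _).trans (h e he).2
    rw [norm_pow, norm_norm] at this
    nlinarith [lt_of_le_of_ne (by positivity : 0 ≤ ‖e‖ ^ j) (Ne.symm hc.2)]
  have hb : ∀ x ∈ Metric.closedBall (0 : 𝕜) ‖e‖, ‖f' x‖ ≤ |C| * ‖e‖ ^ j := by
    intro x hx
    refine (h x (hsub hx)).2.trans ?_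
    rw [norm_pow, norm_norm]
    have hx' : ‖x‖ ≤ ‖e‖ := by simpa using hx
    gcongr
    exact le_abs_self C
  have := (convex_closedBall (0 : 𝕜) ‖e‖).norm_image_sub_le_of_norm_hasDerivWithin_le
    (fun x hx => (h x (hsub hx)).1.hasDerivWithinAt) hb
    (Metric.mem_closedBall_self (norm_nonneg e)) (by simp : e ∈ Metric.closedBall (0 : 𝕜) ‖e‖)
  rw [h0, sub_zero, sub_zero] at this
  rw [norm_pow, norm_norm, pow_succ, ← mul_assoc]
  rcases hC0 with hC0 | hC0
  · rwa [abs_of_nonneg hC0] at this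
  · simpa [hC0] using this

lemma eventually_eq_zero_of_isBigO_pow {f : 𝕜 → 𝕜} (hf : AnalyticAt 𝕜 f 0)
    (h : ∀ j : ℕ, f =O[𝓝 0] fun e => ‖e‖ ^ j) : ∀ᶠ e in 𝓝 0, f e = 0 := by
  by_contra hne
  obtain ⟨n, g, hg, hg0, hfg⟩ := hf.exists_eventuallyEq_pow_smul_nonzero_iff.2 hne
  obtain ⟨C, hC⟩ := (h (n + 1)).bound
  have hle : ∀ᶠ e in 𝓝[≠] (0 : 𝕜), ‖g e‖ ≤ C * ‖e‖ := by
    filter_upwards [(hfg.and hC).filter_mono nhdsWithin_le_nhds, self_mem_nhdsWithin] with e he he0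
    have hpos : 0 < ‖e‖ := norm_pos_iff.2 he0
    obtain ⟨h1, h2⟩ := he
    rw [h1, sub_zero, norm_smul, norm_pow, norm_pow, norm_norm, pow_succ] at h2
    have : ‖e‖ ^ n * ‖g e‖ ≤ ‖e‖ ^ n * (C * ‖e‖) := by linarith
    exact le_of_mul_le_mul_left this (by positivity)
  have hlim : Tendsto (fun e : 𝕜 => C * ‖e‖) (𝓝[≠] 0) (𝓝 0) := by
    have : Tendsto (fun e : 𝕜 => C * ‖e‖) (𝓝 0) (𝓝 (C * ‖(0 : 𝕜)‖)) :=
      (continuous_const.mul continuous_norm).tendsto _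
    rw [norm_zero, mul_zero] at this
    exact this.mono_left nhdsWithin_le_nhds
  have hlim' : Tendsto (fun e : 𝕜 => ‖g e‖) (𝓝[≠] 0) (𝓝 ‖g 0‖) :=
    hg.continuousAt.norm.tendsto.mono_left nhdsWithin_le_nhds
  exact hg0 (norm_le_zero_iff.1 (le_of_tendsto_of_tendsto hlim' hlim hle))

end Families

/-! ### Discrete shifts of a classical Baker function -/

section DiscreteShift

open Filter Topology Asymptotics

variable {𝕜 : Type*} [RCLike 𝕜] {m : ℕ}

instance isScalarTower_laurent : IsScalarTower 𝕜 𝕜⸨X⸩ 𝕜⸨X⸩ := by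
  refine ⟨fun c x y => ?_⟩
  rw [smul_eq_mul, smul_eq_mul, ← HahnSeries.C_mul_eq_smul, ← HahnSeries.C_mul_eq_smul, mul_assoc]

instance smulCommClass_laurent : SMulCommClass 𝕜 𝕜⸨X⸩ 𝕜⸨X⸩ := by
  refine ⟨fun c x y => ?_⟩
  rw [smul_eq_mul, smul_eq_mul, ← HahnSeries.C_mul_eq_smul, ← HahnSeries.C_mul_eq_smul]
  ring

instance smulCommClass_laurent_symm : SMulCommClass 𝕜⸨X⸩ 𝕜 𝕜⸨X⸩ :=
  SMulCommClass.symm _ _ _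

lemma constMat_diagonal (b : Fin m → 𝕜) :
    constMat (Matrix.diagonal b) = ∑ α, b α • unitMat 𝕜 α := by
  refine ext_lcoeff fun n => ?_
  simp only [lcoeff_sum, lcoeff_smul, unitMat_eq_constMat, lcoeff_constMat]
  split_ifs
  · ext i j
    simp only [Matrix.sum_apply, Matrix.smul_apply, Matrix.single_apply, Matrix.diagonal_apply]
    by_cases hij : i = j
    · subst hij; simp
    · rw [if_neg hij, Finset.sum_eq_zero]
      rintro x -
      rw [if_neg (by rintro ⟨rfl, rfl⟩; exact hij rfl), smul_zero]
  · simp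

lemma zA_pow (a : Fin m → 𝕜) (k : ℕ) :
    zA a ^ k = ∑ α, a α ^ k • (zvar 𝕜 ^ k • unitMat 𝕜 α) := by
  have h : constMat (Matrix.diagonal a) ^ k = constMat (Matrix.diagonal (a ^ k)) := by
    rw [← Matrix.diagonal_pow]
    exact (map_pow (HahnSeries.C : 𝕜 →+* 𝕜⸨X⸩).mapMatrix (Matrix.diagonal a) k).symm
  rw [zA, smul_pow, h, constMat_diagonal, Finset.smul_sum]
  exact Finset.sum_congr rfl fun α _ => by rw [Pi.pow_apply, smul_comm]

lemma toLaurent_sum {ι : Type*} (s : Finset ι) (P : ι → Matrix (Fin m) (Fin m) 𝕜⟦X⟧) :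
    toLaurent (∑ i ∈ s, P i) = ∑ i ∈ s, toLaurent (P i) :=
  map_sum ((HahnSeries.ofPowerSeries ℤ 𝕜).mapMatrix) P s

lemma toLaurent_smul (c : 𝕜) (P : Matrix (Fin m) (Fin m) 𝕜⟦X⟧) :
    toLaurent (c • P) = c • toLaurent P := by
  refine ext_lcoeff fun n => ?_
  rw [lcoeff_smul]
  rcases lt_or_ge n 0 with h | h
  · rw [orderGE_toLaurent _ n h, orderGE_toLaurent _ n h, smul_zero]
  · obtain ⟨j, rfl⟩ := Int.eq_ofNat_of_zero_le h
    rw [lcoeff_toLaurent j, lcoeff_toLaurent j]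
    ext p q
    simp

/-- The generator of the evolution in the scaling parameter `e` of the discrete shift, up to
order `N`. -/
noncomputable def stepGenerator (a : Fin m → 𝕜) (N : ℕ) (e : 𝕜)
    (W : Matrix (Fin m) (Fin m) 𝕜⟦X⟧) : Matrix (Fin m) (Fin m) 𝕜⸨X⸩ :=
  ∑ k ∈ Finset.range N, ∑ α, ((-e) ^ k * a α ^ (k + 1)) • Bmat W (k + 1) α

lemma orderGE_stepGenerator (a : Fin m → 𝕜) (N : ℕ) (e : 𝕜)
    {W : Matrix (Fin m) (Fin m) 𝕜⟦X⟧} (hW : W.map PowerSeries.constantCoeff = 1) :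
    OrderGE (-N) (stepGenerator a N e W) := by
  intro n hn
  simp only [stepGenerator, lcoeff_sum, lcoeff_smul]
  refine Finset.sum_eq_zero fun k hk => Finset.sum_eq_zero fun α _ => ?_
  have := Finset.mem_range.1 hk
  rw [orderGE_Bmat hW (k + 1) α n (by push_cast; omega), smul_zero]

lemma lcoeff_stepGenerator_of_one_le (a : Fin m → 𝕜) (N : ℕ) (e : 𝕜)
    (W : Matrix (Fin m) (Fin m) 𝕜⟦X⟧) {n : ℤ} (hn : 1 ≤ n) :
    lcoeff n (stepGenerator a N e W) = 0 := by
  simp only [stepGenerator, lcoeff_sum, lcoeff_smul]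
  refine Finset.sum_eq_zero fun k _ => Finset.sum_eq_zero fun α _ => ?_
  rw [lcoeff_Bmat_of_one_le _ _ _ _ hn, smul_zero]

/-- The derivative of `ŵ (1 + e z A)` in the scaling parameter `e` of the discrete shift is
`stepGenerator * ŵ (1 + e z A)` up to terms of order `e ^ N`. -/
lemma derivative_mul_one_add_zA {ρ : ℝ} {a : Fin m → 𝕜}
    {W : Times 𝕜 m → Matrix (Fin m) (Fin m) 𝕜⟦X⟧} {t : Times 𝕜 m}
    (hflow : ∀ k α, partialBaker ρ k α W t = Bmat (W t) k α * toLaurent (W t))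
    (N : ℕ) (e : 𝕜) (R : Matrix (Fin m) (Fin m) 𝕜⟦X⟧) :
    toLaurent (∑ k ∈ Finset.range N, ∑ α, ((-e) ^ k * a α ^ (k + 1)) • partialW ρ (k + 1) α W t
        + e ^ N • R) * (1 + e • zA a) + toLaurent (W t) * zA a
      = stepGenerator a N e (W t) * (toLaurent (W t) * (1 + e • zA a))
        + e ^ N • (toLaurent (W t) * (zA a * (-zA a) ^ N) + toLaurent R * (1 + e • zA a)) := by
  have hp : ∀ k α, toLaurent (partialW ρ k α W t)
      = Bmat (W t) k α * toLaurent (W t) - toLaurent (W t) * (zvar 𝕜 ^ k • unitMat 𝕜 α) :=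
    fun k α => by rw [← hflow, partialBaker, add_sub_cancel_right]
  have hS : toLaurent (∑ k ∈ Finset.range N, ∑ α,
        ((-e) ^ k * a α ^ (k + 1)) • partialW ρ (k + 1) α W t)
      = stepGenerator a N e (W t) * toLaurent (W t)
        - toLaurent (W t) * ((∑ k ∈ Finset.range N, (-(e • zA a)) ^ k) * zA a) := by
    simp only [toLaurent_sum, toLaurent_smul, hp, smul_sub, Finset.sum_sub_distrib, stepGenerator,
      Finset.sum_mul, Finset.mul_sum, smul_mul_assoc]
    congr 1
    refine Finset.sum_congr rfl fun k _ => ?_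
    rw [← neg_smul, smul_pow, smul_mul_assoc, ← pow_succ, zA_pow, mul_smul_comm, Finset.mul_sum,
      Finset.smul_sum]
    refine Finset.sum_congr rfl fun α _ => ?_
    rw [mul_smul_comm (a α ^ (k + 1)), smul_smul]
  have hgeom : (∑ k ∈ Finset.range N, (-(e • zA a)) ^ k) * zA a * (1 + e • zA a)
      = zA a - e ^ N • (zA a * (-zA a) ^ N) := by
    have h1 := geom_sum_mul_neg (-(e • zA a)) N
    have hc : zA a * (1 + e • zA a) = (1 + e • zA a) * zA a := by
      rw [mul_add, add_mul, one_mul, mul_one, mul_smul_comm, smul_mul_assoc]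
    rw [sub_neg_eq_add] at h1
    rw [mul_assoc, hc, ← mul_assoc, h1, sub_mul, one_mul, ← smul_neg, smul_pow, smul_mul_assoc,
      ((Commute.refl (zA a)).neg_right.pow_right N).eq]
  rw [toLaurent_add, toLaurent_smul, hS, add_mul, sub_mul, mul_assoc (toLaurent (W t)), hgeom,
    mul_sub, mul_assoc, mul_smul_comm, smul_add, smul_mul_assoc]
  abel

end DiscreteShift

section LocalVanishing

open Filter Topology Asymptotics

variable {𝕜 : Type*} [RCLike 𝕜] {m : ℕ}

lemma exists_orderGE (F : Matrix (Fin m) (Fin m) 𝕜⸨X⸩) : ∃ d, OrderGE d F := by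
  refine ⟨-∑ p, ∑ q, |(F p q).order|, fun n hn => ?_⟩
  ext p q
  refine HahnSeries.coeff_eq_zero_of_lt_order (lt_of_lt_of_le hn ?_)
  have h1 : |(F p q).order| ≤ ∑ q, |(F p q).order| :=
    Finset.single_le_sum (f := fun q => |(F p q).order|) (fun _ _ => abs_nonneg _)
      (Finset.mem_univ q)
  have h2 : ∑ q, |(F p q).order| ≤ ∑ p, ∑ q, |(F p q).order| :=
    Finset.single_le_sum (f := fun p => ∑ q, |(F p q).order|)
      (fun _ _ => Finset.sum_nonneg fun _ _ => abs_nonneg _) (Finset.mem_univ p)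
  have h3 := neg_abs_le (F p q).order
  omega

/-- A family of dressing matrices with analytic coefficients that satisfies the classical flow
equations on an open set of times. -/
structure IsAnalyticFlow (ρ : ℝ) (D : Set (Times 𝕜 m))
    (W : Times 𝕜 m → Matrix (Fin m) (Fin m) 𝕜⟦X⟧) : Prop where
  isOpen : IsOpen D
  analytic : ∀ t ∈ D, ∀ j p q, AnalyticAt 𝕜 (fun s => PowerSeries.coeff j (W s p q)) t
  normalized : ∀ t ∈ D, (W t).map PowerSeries.constantCoeff = 1
  flow : ∀ t ∈ D, ∀ k α, partialBaker ρ k α W t = Bmat (W t) k α * toLaurent (W t)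

variable {ρ : ℝ} {a : Fin m → 𝕜} {D : Set (Times 𝕜 m)}
  {W : Times 𝕜 m → Matrix (Fin m) (Fin m) 𝕜⟦X⟧} {t : Times 𝕜 m}

lemma coeff_partialW (hW : IsAnalyticFlow ρ D W) (ht : t ∈ D) (k : ℕ) (α : Fin m) (j : ℕ)
    (p q : Fin m) : PowerSeries.coeff j (partialW ρ k α W t p q)
      = fderiv 𝕜 (fun s => PowerSeries.coeff j (W s p q)) t (timeDir 𝕜 ρ k α) := by
  rw [partialW, Matrix.of_apply, PowerSeries.coeff_mk,
    (hW.analytic t ht j p q).differentiableAt.lineDeriv_eq_fderiv]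

/-- The path `e ↦ t + [e a]`. -/
noncomputable def stepPath (ρ : ℝ) (a : Fin m → 𝕜) (t : Times 𝕜 m) (e : 𝕜) : Times 𝕜 m :=
  t + stepVec ρ fun α => e * a α

lemma stepPath_zero (ρ : ℝ) (a : Fin m → 𝕜) (t : Times 𝕜 m) : stepPath ρ a t 0 = t := by
  simp [stepPath, stepVec_zero]

lemma analyticAt_stepPath (hρ : 0 < ρ) (ha : ∀ α, ρ * ‖a α‖ < 1) (t : Times 𝕜 m) {e : 𝕜}
    (he : ‖e‖ ≤ 1) : AnalyticAt 𝕜 (stepPath ρ a t) e :=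
  analyticAt_const.add (analyticAt_stepVec hρ ha he)

lemma tendsto_stepPath (hρ : 0 < ρ) (ha : ∀ α, ρ * ‖a α‖ < 1) (t : Times 𝕜 m) :
    Tendsto (stepPath ρ a t) (𝓝 0) (𝓝 t) := by
  have h := (analyticAt_stepPath hρ ha t (e := (0 : 𝕜)) (by simp)).continuousAt.tendsto
  rwa [stepPath_zero] at h

lemma isBigO_coeff_stepPath (hρ : 0 < ρ) (ha : ∀ α, ρ * ‖a α‖ < 1) (hW : IsAnalyticFlow ρ D W)
    (ht : t ∈ D) (j : ℕ) (p q : Fin m) :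
    (fun e => PowerSeries.coeff j (W (stepPath ρ a t e) p q)) =O[𝓝 0] fun _ => (1 : ℝ) :=
  ((hW.analytic t ht j p q).continuousAt.tendsto.comp (tendsto_stepPath hρ ha t)).isBigO_one ℝ

lemma isBigO_fderiv_coeff_stepPath (hρ : 0 < ρ) (ha : ∀ α, ρ * ‖a α‖ < 1)
    (hW : IsAnalyticFlow ρ D W) (ht : t ∈ D) {R : 𝕜 → Times 𝕜 m} (hR : ContinuousAt R 0) (j : ℕ)
    (p q : Fin m) :
    (fun e => fderiv 𝕜 (fun s => PowerSeries.coeff j (W s p q)) (stepPath ρ a t e) (R e))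
      =O[𝓝 0] fun _ => (1 : ℝ) := by
  have h : ContinuousAt (fun e => fderiv 𝕜 (fun s => PowerSeries.coeff j (W s p q))
      (stepPath ρ a t e)) 0 :=
    ContinuousAt.comp_of_eq (hW.analytic t ht j p q).fderiv.continuousAt
      (analyticAt_stepPath hρ ha t (by simp)).continuousAt (stepPath_zero ρ a t)
  exact (h.clm_apply hR).tendsto.isBigO_one ℝ

lemma matBigO_lcoeff_Bmat (hρ : 0 < ρ) (ha : ∀ α, ρ * ‖a α‖ < 1) (hW : IsAnalyticFlow ρ D W)
    (ht : t ∈ D) (k : ℕ) (α : Fin m) (n : ℤ) :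
    MatBigO (fun e => lcoeff n (Bmat (W (stepPath ρ a t e)) k α)) fun _ => 1 := by
  have hD : ∀ᶠ e in 𝓝 0, stepPath ρ a t e ∈ D :=
    (tendsto_stepPath hρ ha t).eventually (hW.isOpen.mem_nhds ht)
  have hb : ∀ n, MatBigO (fun e => lcoeff n (toLaurent (W (stepPath ρ a t e)))) fun _ => 1 := by
    intro n
    simpa using matBigO_lcoeff_toLaurent_mul
      (fun j p q => isBigO_coeff_stepPath hρ ha hW ht j p q) orderGE_one n
  refine matBigO_lcoeff_of_mul (hD.mono fun e he => orderGE_Bmat (hW.normalized _ he) k α)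
    (hD.mono fun e he => hW.normalized _ he) hb (fun n => ?_) n
  obtain ⟨d, hd⟩ := exists_orderGE (zvar 𝕜 ^ k • unitMat 𝕜 α)
  have h1 := matBigO_lcoeff_toLaurent_mul
      (fun j p q => isBigO_coeff_stepPath hρ ha hW ht j p q) hd n
  have h2 := matBigO_lcoeff_toLaurent_mul (P := fun e => partialW ρ k α W (stepPath ρ a t e))
    (g := fun _ => (1 : ℝ)) (fun j p q => by
      refine (isBigO_fderiv_coeff_stepPath hρ ha hW ht
        (continuousAt_const (y := timeDir 𝕜 ρ k α)) j p q).congr' ?_ EventuallyEq.rfl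
      filter_upwards [hD] with e he
      rw [coeff_partialW hW he]) orderGE_one n
  simp only [mul_one] at h2
  refine (h2.add h1).congr' ?_
  filter_upwards [hD] with e he
  rw [← hW.flow _ he, partialBaker, lcoeff_add]

/-- `ŵ(t + [e a]) (1 + e z A) ŵ(t)⁻¹`. -/
noncomputable def transfer (ρ : ℝ) (a : Fin m → 𝕜)
    (W : Times 𝕜 m → Matrix (Fin m) (Fin m) 𝕜⟦X⟧) (t : Times 𝕜 m) (e : 𝕜) :
    Matrix (Fin m) (Fin m) 𝕜⸨X⸩ :=
  toLaurent (W (stepPath ρ a t e)) * (1 + e • zA a) * toLaurent (W t)⁻¹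

lemma mul_one_add_smul_zA_mul (a : Fin m → 𝕜) (F Y : Matrix (Fin m) (Fin m) 𝕜⸨X⸩) (e : 𝕜) :
    F * (1 + e • zA a) * Y = F * Y + e • (F * (zA a * Y)) := by
  rw [mul_add, mul_one, add_mul, mul_smul_comm, smul_mul_assoc, mul_assoc]

lemma orderGE_transfer (e : 𝕜) : OrderGE (-1) (transfer ρ a W t e) := by
  have h : OrderGE (-1) (1 + e • zA a) := by
    refine (orderGE_one.mono (by omega)).add fun n hn => ?_
    rw [lcoeff_smul, orderGE_zA a n hn, smul_zero]
  rw [transfer]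
  simpa using ((orderGE_toLaurent (W (stepPath ρ a t e))).mul h).mul
    (orderGE_toLaurent (W t)⁻¹)

lemma analyticAt_lcoeff_mul_one_add_zA {P : 𝕜 → Matrix (Fin m) (Fin m) 𝕜⟦X⟧} {e₀ : 𝕜}
    (hP : ∀ j p q, AnalyticAt 𝕜 (fun e => PowerSeries.coeff j (P e p q)) e₀)
    (Y : Matrix (Fin m) (Fin m) 𝕜⸨X⸩) (n : ℤ) (p q : Fin m) :
    AnalyticAt 𝕜 (fun e => lcoeff n (toLaurent (P e) * (1 + e • zA a) * Y) p q) e₀ := by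
  simp only [mul_one_add_smul_zA_mul, lcoeff_add, lcoeff_smul, Matrix.add_apply,
    Matrix.smul_apply, smul_eq_mul]
  obtain ⟨d, hd⟩ := exists_orderGE Y
  obtain ⟨d', hd'⟩ := exists_orderGE (zA a * Y)
  exact (analyticAt_lcoeff_toLaurent_mul hP hd n p q).add
    (analyticAt_id.mul (analyticAt_lcoeff_toLaurent_mul hP hd' n p q))

lemma hasDerivAt_lcoeff_mul_one_add_zA {P : 𝕜 → Matrix (Fin m) (Fin m) 𝕜⟦X⟧} {e : 𝕜}
    {V : Matrix (Fin m) (Fin m) 𝕜⟦X⟧}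
    (hP : ∀ j p q, HasDerivAt (fun e => PowerSeries.coeff j (P e p q))
      (PowerSeries.coeff j (V p q)) e)
    (Y : Matrix (Fin m) (Fin m) 𝕜⸨X⸩) (n : ℤ) (p q : Fin m) :
    HasDerivAt (fun e => lcoeff n (toLaurent (P e) * (1 + e • zA a) * Y) p q)
      (lcoeff n ((toLaurent V * (1 + e • zA a) + toLaurent (P e) * zA a) * Y) p q) e := by
  obtain ⟨d, hd⟩ := exists_orderGE Y
  obtain ⟨d', hd'⟩ := exists_orderGE (zA a * Y)
  have h := (hasDerivAt_lcoeff_toLaurent_mul hP hd n p q).add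
    ((hasDerivAt_id e).mul (hasDerivAt_lcoeff_toLaurent_mul hP hd' n p q))
  simp only [mul_one_add_smul_zA_mul, add_mul (_ * _), lcoeff_add, lcoeff_smul, Matrix.add_apply,
    Matrix.smul_apply, smul_eq_mul]
  refine h.congr_deriv ?_
  rw [mul_assoc (toLaurent (P e))]
  simp only [id_eq, one_mul]
  ring

lemma analyticAt_lcoeff_transfer (hρ : 0 < ρ) (ha : ∀ α, ρ * ‖a α‖ < 1)
    (hW : IsAnalyticFlow ρ D W) (ht : t ∈ D) (n : ℤ) (p q : Fin m) :
    AnalyticAt 𝕜 (fun e => lcoeff n (transfer ρ a W t e) p q) 0 :=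
  analyticAt_lcoeff_mul_one_add_zA (fun j p q => (hW.analytic t ht j p q).comp_of_eq
    (analyticAt_stepPath hρ ha t (by simp)) (stepPath_zero ρ a t)) _ n p q

lemma exists_hasDerivAt_lcoeff_transfer (hρ : 0 < ρ) (ha : ∀ α, ρ * ‖a α‖ < 1)
    (hW : IsAnalyticFlow ρ D W) (ht : t ∈ D) (N : ℕ) (n : ℤ) :
    ∃ Q : 𝕜 → Matrix (Fin m) (Fin m) 𝕜, MatBigO Q (fun _ => 1) ∧ ∀ᶠ e in 𝓝 0, ∀ p q,
      HasDerivAt (fun e => lcoeff n (transfer ρ a W t e) p q)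
        ((lcoeff n (stepGenerator a N e (W (stepPath ρ a t e)) * transfer ρ a W t e)
          + e ^ N • Q e) p q) e := by
  obtain ⟨R, hR, hder⟩ := exists_hasDerivAt_stepVec (𝕜 := 𝕜) hρ ha N
  have hD : ∀ᶠ e in 𝓝 0, stepPath ρ a t e ∈ D :=
    (tendsto_stepPath hρ ha t).eventually (hW.isOpen.mem_nhds ht)
  set Y := toLaurent (W t)⁻¹ with hY
  let S : 𝕜 → Matrix (Fin m) (Fin m) 𝕜⟦X⟧ := fun e => Matrix.of fun p q => PowerSeries.mk fun j =>
    fderiv 𝕜 (fun s => PowerSeries.coeff j (W s p q)) (stepPath ρ a t e) (R e)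
  have hS : ∀ j p q, (fun e => PowerSeries.coeff j (S e p q)) =O[𝓝 0] fun _ => (1 : ℝ) := by
    intro j p q
    simpa [S] using isBigO_fderiv_coeff_stepPath hρ ha hW ht hR j p q
  refine ⟨fun e => lcoeff n (toLaurent (W (stepPath ρ a t e)) * (zA a * (-zA a) ^ N * Y))
    + (lcoeff n (toLaurent (S e) * Y) + e • lcoeff n (toLaurent (S e) * (zA a * Y))), ?_, ?_⟩
  · obtain ⟨d, hd⟩ := exists_orderGE (zA a * (-zA a) ^ N * Y)
    obtain ⟨d', hd'⟩ := exists_orderGE Y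
    obtain ⟨d'', hd''⟩ := exists_orderGE (zA a * Y)
    have he : (fun e : 𝕜 => e) =O[𝓝 0] fun _ => (1 : ℝ) :=
      (tendsto_id (x := 𝓝 (0 : 𝕜))).isBigO_one ℝ
    have h3 := MatBigO.smul he (matBigO_lcoeff_toLaurent_mul hS hd'' n)
    simp only [mul_one] at h3
    exact (matBigO_lcoeff_toLaurent_mul
      (fun j p q => isBigO_coeff_stepPath hρ ha hW ht j p q) hd n).add
      ((matBigO_lcoeff_toLaurent_mul hS hd' n).add h3)
  · filter_upwards [hder, hD] with e he heD p q
    have hpath : HasDerivAt (stepPath ρ a t) _ e := he.const_add t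
    have h := hasDerivAt_lcoeff_mul_one_add_zA (a := a) (e := e)
      (P := fun e => W (stepPath ρ a t e))
      (V := ∑ k ∈ Finset.range N, ∑ α, ((-e) ^ k * a α ^ (k + 1)) •
        partialW ρ (k + 1) α W (stepPath ρ a t e) + e ^ N • S e) (fun j p q => by
          refine ((hW.analytic _ heD j p q).differentiableAt.hasFDerivAt.comp_hasDerivAt e
            hpath).congr_deriv ?_
          simp only [map_add, map_sum, map_smul, Matrix.add_apply, Matrix.sum_apply,
            Matrix.smul_apply, coeff_partialW hW heD, S, Matrix.of_apply, PowerSeries.coeff_mk])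
      Y n p q
    refine h.congr_deriv ?_
    rw [derivative_mul_one_add_zA (hW.flow _ heD), add_mul, lcoeff_add, mul_assoc,
      smul_mul_assoc, lcoeff_smul, add_mul, lcoeff_add,
      mul_one_add_smul_zA_mul a (toLaurent (S e)), lcoeff_add, lcoeff_smul,
      mul_assoc (toLaurent _) (zA a * _), transfer]

lemma matBigO_lcoeff_transfer (hρ : 0 < ρ) (ha : ∀ α, ρ * ‖a α‖ < 1)
    (hW : IsAnalyticFlow ρ D W) (ht : t ∈ D) (j : ℕ) :
    ∀ n ≥ 1, MatBigO (fun e => lcoeff n (transfer ρ a W t e)) fun e => ‖e‖ ^ j := by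
  have hD : ∀ᶠ e in 𝓝 0, stepPath ρ a t e ∈ D :=
    (tendsto_stepPath hρ ha t).eventually (hW.isOpen.mem_nhds ht)
  induction j with
  | zero =>
    intro n _ p q
    simp only [pow_zero]
    exact (analyticAt_lcoeff_transfer hρ ha hW ht n p q).continuousAt.tendsto.isBigO_one ℝ
  | succ j ih =>
    intro n hn p q
    obtain ⟨Q, hQ, hder⟩ := exists_hasDerivAt_lcoeff_transfer hρ ha hW ht j n
    refine isBigO_pow_succ_of_deriv (hder.mono fun e he => he p q) ?_ ?_
    · rw [transfer, stepPath_zero, zero_smul, add_zero, mul_one,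
        toLaurent_mul_inv (hW.normalized t ht), lcoeff_one, if_neg (by omega), Matrix.zero_apply]
    · have hpow : (fun e : 𝕜 => e ^ j) =O[𝓝 0] fun e => ‖e‖ ^ j :=
        IsBigO.of_bound 1 (Eventually.of_forall fun e => by simp)
      have hQ' := MatBigO.smul hpow hQ
      simp only [mul_one] at hQ'
      have hM : ∀ i, MatBigO (fun e => lcoeff i (stepGenerator a j e (W (stepPath ρ a t e))))
          fun _ => 1 := by
        intro i
        simp only [stepGenerator, lcoeff_sum, lcoeff_smul]
        refine MatBigO.sum fun k _ => MatBigO.sum fun α _ => ?_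
        have hc : (fun e : 𝕜 => (-e) ^ k * a α ^ (k + 1)) =O[𝓝 0] fun _ => (1 : ℝ) := by
          have : Continuous fun e : 𝕜 => (-e) ^ k * a α ^ (k + 1) := by fun_prop
          exact (this.tendsto 0).isBigO_one ℝ
        simpa using MatBigO.smul hc (matBigO_lcoeff_Bmat hρ ha hW ht (k + 1) α i)
      have hMG : MatBigO (fun e => lcoeff n
          (stepGenerator a j e (W (stepPath ρ a t e)) * transfer ρ a W t e)) fun e => ‖e‖ ^ j := by
        have : MatBigO (fun e => ∑ i ∈ Finset.Icc (-(j : ℤ)) (n - -1),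
            lcoeff i (stepGenerator a j e (W (stepPath ρ a t e)))
              * lcoeff (n - i) (transfer ρ a W t e)) fun e => ‖e‖ ^ j := by
          refine MatBigO.sum fun i _ => ?_
          rcases le_or_gt 1 i with hi | hi
          · refine MatBigO.of_eventually_zero (Eventually.of_forall fun e => ?_)
            rw [lcoeff_stepGenerator_of_one_le _ _ _ _ hi, zero_mul]
          · simpa using (hM i).mul (ih (n - i) (by omega))
        refine this.congr' ?_
        filter_upwards [hD] with e he
        rw [lcoeff_mul (orderGE_stepGenerator a j e (hW.normalized _ he)) (orderGE_transfer e)]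
      exact (hMG.add hQ') p q

lemma eventually_lcoeff_transfer_eq_zero (hρ : 0 < ρ) (ha : ∀ α, ρ * ‖a α‖ < 1)
    (hW : IsAnalyticFlow ρ D W) (ht : t ∈ D) {n : ℤ} (hn : 1 ≤ n) (p q : Fin m) :
    ∀ᶠ e in 𝓝 0, lcoeff n (transfer ρ a W t e) p q = 0 :=
  eventually_eq_zero_of_isBigO_pow (analyticAt_lcoeff_transfer hρ ha hW ht n p q)
    fun j => matBigO_lcoeff_transfer hρ ha hW ht j n hn p q

end LocalVanishing

section DiscreteBaker

open Filter Topology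

variable {𝕜 : Type*} [RCLike 𝕜] {m : ℕ} {ρ : ℝ} {a : Fin m → 𝕜}

/-! ### The discrete Lax operator of a classical flow -/

/-- The potential `A w₁(t) - w₁(t + [a]) A` of the discrete Lax operator. -/
noncomputable def discPotential (ρ : ℝ) (a : Fin m → 𝕜)
    (W : Times 𝕜 m → Matrix (Fin m) (Fin m) 𝕜⟦X⟧) (t : Times 𝕜 m) : Matrix (Fin m) (Fin m) 𝕜 :=
  Matrix.diagonal a * (W t).map (PowerSeries.coeff 1)
    - (W (t + stepVec ρ a)).map (PowerSeries.coeff 1) * Matrix.diagonal a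

lemma lcoeff_one_toLaurent (W : Matrix (Fin m) (Fin m) 𝕜⟦X⟧) :
    lcoeff 1 (toLaurent W) = W.map (PowerSeries.coeff 1) := by
  simpa using lcoeff_toLaurent 1 W

/-- If `ŵ' (1 + z A) ŵ⁻¹` has no negative powers of `z`, it is `1 + z A - U`. -/
lemma mul_one_add_zA_eq {V W : Matrix (Fin m) (Fin m) 𝕜⟦X⟧}
    (hV : V.map PowerSeries.constantCoeff = 1) (hW : W.map PowerSeries.constantCoeff = 1)
    (h : ∀ n ≥ 1, lcoeff n (toLaurent V * (1 + zA a) * toLaurent W⁻¹) = 0) :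
    toLaurent V * (1 + zA a)
      = (1 + zA a - constMat (Matrix.diagonal a * W.map (PowerSeries.coeff 1)
          - V.map (PowerSeries.coeff 1) * Matrix.diagonal a)) * toLaurent W := by
  set G := toLaurent V * (1 + zA a) * toLaurent W⁻¹ with hG
  have hGW : G * toLaurent W = toLaurent V * (1 + zA a) := by
    rw [hG, mul_assoc, toLaurent_inv_mul hW, mul_one]
  have hord : OrderGE (-1) G := by
    rw [hG]
    simpa using ((orderGE_toLaurent V).mul
      ((orderGE_one.mono (by omega)).add (orderGE_zA a))).mul (orderGE_toLaurent W⁻¹)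
  have hm1 : lcoeff (-1) G = Matrix.diagonal a := by
    have h1 := lcoeff_add_mul hord (orderGE_toLaurent W)
    rw [hGW, lcoeff_zero_toLaurent hW, mul_one, mul_add, mul_one, lcoeff_add, lcoeff_mul_zA,
      orderGE_toLaurent V _ (by omega)] at h1
    simpa [lcoeff_zero_toLaurent hV] using h1.symm
  have h0 : lcoeff 0 G = 1 + V.map (PowerSeries.coeff 1) * Matrix.diagonal a
      - Matrix.diagonal a * W.map (PowerSeries.coeff 1) := by
    have h1 := lcoeff_mul hord (orderGE_toLaurent W) 0
    rw [hGW, mul_add, mul_one, lcoeff_add, lcoeff_mul_zA, lcoeff_zero_toLaurent hV, zero_add,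
      lcoeff_one_toLaurent, show Finset.Icc (-1 : ℤ) (0 - 0) = {-1, 0} by decide,
      Finset.sum_pair (by decide), hm1, sub_zero, lcoeff_zero_toLaurent hW, mul_one, zero_sub,
      neg_neg, lcoeff_one_toLaurent] at h1
    rw [h1, add_sub_cancel_left]
  rw [← hGW]
  congr 1
  refine ext_lcoeff fun n => ?_
  rw [lcoeff_sub, lcoeff_add, lcoeff_one, lcoeff_zA, lcoeff_constMat]
  rcases lt_trichotomy n 0 with hn | rfl | hn
  · rw [if_neg (by omega : ¬n = 0), if_neg (by omega : ¬n = 0), sub_zero, zero_add]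
    rcases eq_or_ne n (-1) with rfl | hn'
    · rw [if_pos rfl, hm1]
    · rw [if_neg hn', hord n (by omega)]
  · rw [h0, if_pos rfl, if_pos rfl, if_neg (by decide)]
    abel
  · rw [h n hn, if_neg (by omega), if_neg (by omega), if_neg (by omega)]
    simp

lemma unitMat_mul_zA (a : Fin m → 𝕜) (k : ℕ) (α : Fin m) :
    (zvar 𝕜 ^ k • unitMat 𝕜 α) * zA a = zA a * (zvar 𝕜 ^ k • unitMat 𝕜 α) := by
  have h : unitMat 𝕜 α * constMat (Matrix.diagonal a)
      = constMat (Matrix.diagonal a) * unitMat 𝕜 α := by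
    have hu : unitMat 𝕜 α = Matrix.diagonal (Pi.single α 1) := by
      rw [Matrix.diagonal_single]; rfl
    have hc : constMat (Matrix.diagonal a) = Matrix.diagonal fun i => HahnSeries.C (a i) := by
      rw [constMat, Matrix.diagonal_map (map_zero _)]
    rw [hu, hc, Matrix.diagonal_mul_diagonal, Matrix.diagonal_mul_diagonal]
    simp only [mul_comm]
  rw [zA, smul_mul_smul_comm, smul_mul_smul_comm, h, mul_comm]

lemma orderGE_one_partialW {D : Set (Times 𝕜 m)} {W : Times 𝕜 m → Matrix (Fin m) (Fin m) 𝕜⟦X⟧}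
    {t : Times 𝕜 m} (hW : IsAnalyticFlow ρ D W) (ht : t ∈ D) (k : ℕ) (α : Fin m) :
    OrderGE 1 (toLaurent (partialW ρ k α W t)) := by
  intro n hn
  rcases lt_or_ge n 0 with h | h
  · exact orderGE_toLaurent _ n h
  obtain rfl : n = (0 : ℕ) := by simp only [Nat.cast_zero]; omega
  rw [lcoeff_toLaurent]
  ext p q
  rw [Matrix.map_apply, coeff_partialW hW ht]
  have hc : (fun s => PowerSeries.coeff 0 (W s p q)) =ᶠ[𝓝 t]
      fun _ => (1 : Matrix (Fin m) (Fin m) 𝕜) p q := by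
    filter_upwards [hW.isOpen.mem_nhds ht] with s hs
    rw [← hW.normalized s hs]
    simp
  rw [hc.fderiv_eq]
  simp

lemma partialU_discPotential {D : Set (Times 𝕜 m)}
    {W : Times 𝕜 m → Matrix (Fin m) (Fin m) 𝕜⟦X⟧} {t : Times 𝕜 m} (hW : IsAnalyticFlow ρ D W)
    (ht : t ∈ D) (ht' : t + stepVec ρ a ∈ D) (k : ℕ) (α : Fin m) :
    partialU ρ k α (discPotential ρ a W) t
      = Matrix.diagonal a * lcoeff 1 (toLaurent (partialW ρ k α W t))
        - lcoeff 1 (toLaurent (partialW ρ k α W (t + stepVec ρ a))) * Matrix.diagonal a := by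
  ext p q
  rw [lcoeff_one_toLaurent, lcoeff_one_toLaurent, ← partialW_translate]
  simp only [partialU, discPotential, Matrix.of_apply, Matrix.sub_apply, Matrix.diagonal_mul,
    Matrix.mul_diagonal, Matrix.map_apply, partialW, PowerSeries.coeff_mk]
  have h1 : DifferentiableAt 𝕜 (fun s => PowerSeries.coeff 1 (W s p q)) t :=
    (hW.analytic t ht 1 p q).differentiableAt
  have h2 : DifferentiableAt 𝕜 (fun s => PowerSeries.coeff 1 (W (s + stepVec ρ a) p q)) t :=
    DifferentiableAt.comp (g := fun s => PowerSeries.coeff 1 (W s p q)) t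
      (hW.analytic _ ht' 1 p q).differentiableAt (differentiableAt_id.add_const _)
  have h3 : DifferentiableAt 𝕜 (fun s => a p * PowerSeries.coeff 1 (W s p q)
      - PowerSeries.coeff 1 (W (s + stepVec ρ a) p q) * a q) t :=
    (h1.const_mul (a p)).sub (h2.mul_const (a q))
  rw [h1.lineDeriv_eq_fderiv, h2.lineDeriv_eq_fderiv, h3.lineDeriv_eq_fderiv,
    fderiv_fun_sub (h1.const_mul _) (h2.mul_const _), fderiv_const_mul h1, fderiv_mul_const h2]
  simp [mul_comm]

/-- The Lax equation `∂_{kα} L_D = (Λ B_{kα}) L_D - L_D B_{kα}` at the level of symbols. -/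
lemma constMat_partialU_discPotential {D : Set (Times 𝕜 m)}
    {W : Times 𝕜 m → Matrix (Fin m) (Fin m) 𝕜⟦X⟧} {t : Times 𝕜 m} (hW : IsAnalyticFlow ρ D W)
    (ht : t ∈ D) (ht' : t + stepVec ρ a ∈ D)
    (hT : toLaurent (W (t + stepVec ρ a)) * (1 + zA a)
      = (1 + zA a - constMat (discPotential ρ a W t)) * toLaurent (W t)) (k : ℕ) (α : Fin m) :
    constMat (partialU ρ k α (discPotential ρ a W) t)
      = (1 + zA a - constMat (discPotential ρ a W t)) * Bmat (W t) k α
        - Bmat (W (t + stepVec ρ a)) k α * (1 + zA a - constMat (discPotential ρ a W t)) := by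
  set t' := t + stepVec ρ a
  set U := discPotential ρ a W t
  set T := 1 + zA a - constMat U with hTdef
  set V := toLaurent (partialW ρ k α W t)
  set V' := toLaurent (partialW ρ k α W t')
  obtain ⟨P, hP⟩ : ∃ P, P = T * Bmat (W t) k α - Bmat (W t') k α * T := ⟨_, rfl⟩
  have hf : Bmat (W t) k α * toLaurent (W t)
      = V + toLaurent (W t) * (zvar 𝕜 ^ k • unitMat 𝕜 α) := (hW.flow t ht k α).symm
  have hf' : Bmat (W t') k α * toLaurent (W t')
      = V' + toLaurent (W t') * (zvar 𝕜 ^ k • unitMat 𝕜 α) := (hW.flow t' ht' k α).symm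
  have hPW : P * toLaurent (W t) = T * V - V' * (1 + zA a) := by
    rw [hP, sub_mul, mul_assoc, hf, mul_assoc, ← hT, ← mul_assoc, hf', mul_add, ← mul_assoc T,
      ← hT, add_mul, mul_assoc, mul_assoc _ _ (1 + zA a), mul_add (zvar 𝕜 ^ k • unitMat 𝕜 α),
      unitMat_mul_zA, mul_one, add_mul, one_mul]
    abel
  have hTord : OrderGE (-1) T := by
    intro n hn
    rw [hTdef, lcoeff_sub, lcoeff_add, orderGE_zA a n hn, orderGE_one n (by omega),
      orderGE_constMat U n (by omega)]
    simp
  have hTm1 : lcoeff (-1) T = Matrix.diagonal a := by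
    rw [hTdef, lcoeff_sub, lcoeff_add, lcoeff_zA, lcoeff_one, lcoeff_constMat]
    simp
  have hT1 : ∀ n ≥ 1, lcoeff n T = 0 := by
    intro n hn
    rw [hTdef, lcoeff_sub, lcoeff_add, lcoeff_zA, lcoeff_one, lcoeff_constMat,
      if_neg (by omega), if_neg (by omega), if_neg (by omega)]
    simp
  have hV : OrderGE 1 V := orderGE_one_partialW hW ht k α
  have hV' : OrderGE 1 V' := orderGE_one_partialW hW ht' k α
  have hA : OrderGE (-1) (1 + zA a) := (orderGE_one.mono (by omega)).add (orderGE_zA a)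
  have hTV := hTord.mul hV
  have hVA := hV'.mul hA
  have hord : OrderGE 0 (T * V - V' * (1 + zA a)) := by
    intro n hn
    rw [lcoeff_sub, hTV n (by omega), hVA n (by omega), sub_zero]
  have hP' : P = (T * V - V' * (1 + zA a)) * toLaurent (W t)⁻¹ := by
    rw [← hPW, mul_assoc, toLaurent_mul_inv (hW.normalized t ht), mul_one]
  have h0 : lcoeff 0 P = partialU ρ k α (discPotential ρ a W) t := by
    have h1 := lcoeff_add_mul hord (orderGE_toLaurent (W t)⁻¹)
    have h2 := lcoeff_add_mul hTord hV
    have h3 := lcoeff_add_mul hV' hA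
    rw [hTm1, neg_add_cancel] at h2
    rw [add_neg_cancel, lcoeff_add, lcoeff_zA, lcoeff_one, if_neg (by decide), if_pos rfl,
      zero_add] at h3
    rw [← hP', lcoeff_zero_toLaurent_inv (hW.normalized t ht), mul_one, add_zero, lcoeff_sub, h2,
      h3] at h1
    rw [h1, partialU_discPotential hW ht ht']
  refine ext_lcoeff fun n => ?_
  rw [lcoeff_constMat, ← hP]
  rcases lt_trichotomy n 0 with hn | rfl | hn
  · rw [if_neg hn.ne, hP', (hord.mul (orderGE_toLaurent _)) n (by omega)]
  · rw [if_pos rfl, h0]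
  · rw [if_neg hn.ne', hP, lcoeff_sub,
      lcoeff_mul_eq_zero hTord (orderGE_Bmat (hW.normalized t ht) k α) hT1
        (lcoeff_Bmat_of_one_le _ _ _) hn,
      lcoeff_mul_eq_zero (orderGE_Bmat (hW.normalized t' ht') k α) hTord
        (lcoeff_Bmat_of_one_le _ _ _) hT1 hn, sub_zero]

lemma partialU_translate (ρ : ℝ) (k : ℕ) (α : Fin m)
    (U : Times 𝕜 m → Matrix (Fin m) (Fin m) 𝕜) (v t : Times 𝕜 m) :
    partialU ρ k α (fun s => U (s + v)) t = partialU ρ k α U (t + v) := by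
  simp only [partialU, lineDeriv, add_right_comm t _ v]

/-! ### Analytic continuation along the discrete shift -/

lemma isAnalyticFlow_of_isClassicalTau (hρ : 0 < ρ) {Ω : Set (Times 𝕜 m)} (hΩ : IsOpen Ω)
    {τ : Times 𝕜 m → 𝕜} {τoff : Fin m → Fin m → Times 𝕜 m → 𝕜}
    (hτ : IsClassicalTau ρ a Ω τ τoff) :
    IsAnalyticFlow ρ {t | t ∈ Ω ∧ τ t ≠ 0} (tauDressing ρ τ τoff) where
  isOpen := hτ.analytic.continuousOn.isOpen_inter_preimage hΩ isOpen_compl_singleton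
  analytic t ht := analyticAt_coeff_tauDressing hρ (hτ.analytic t ht.1)
    (fun α β h => hτ.analytic_off α β h t ht.1) ht.2
  normalized := hτ.baker.normalized
  flow := hτ.baker.flow

lemma lcoeff_transfer_one_eq_zero (hρ : 0 < ρ) (ha : ∀ α, ρ * ‖a α‖ < 1) {Ω : Set (Times 𝕜 m)}
    (hΩ : IsOpen Ω)
    (hΩa : ∀ t ∈ Ω, ∀ ε ∈ Set.Icc (0 : ℝ) 1, t + stepVec ρ (fun α => (ε : 𝕜) * a α) ∈ Ω)
    {τ : Times 𝕜 m → 𝕜} {τoff : Fin m → Fin m → Times 𝕜 m → 𝕜}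
    (hτ : IsClassicalTau ρ a Ω τ τoff) {t : Times 𝕜 m} (ht : t ∈ Ω ∧ τ t ≠ 0) (n : ℤ)
    (hn : 1 ≤ n) : lcoeff n (transfer ρ a (tauDressing ρ τ τoff) t 1) = 0 := by
  have hW := isAnalyticFlow_of_isClassicalTau hρ hΩ hτ
  set W := tauDressing ρ τ τoff with hWdef
  have hscale : ∀ e : 𝕜, transfer ρ a W t e = (τ (stepPath ρ a t e))⁻¹ •
      (toLaurent (tauNum ρ τ τoff (stepPath ρ a t e)) * (1 + e • zA a) * toLaurent (W t)⁻¹) := by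
    intro e
    rw [transfer, hWdef, tauDressing_eq_smul, toLaurent_smul, smul_mul_assoc, smul_mul_assoc]
  have hnear : ∀ᶠ e in 𝓝 0, stepPath ρ a t e ∈ {t | t ∈ Ω ∧ τ t ≠ 0} :=
    (tendsto_stepPath hρ ha t).eventually (hW.isOpen.mem_nhds ht)
  ext p q
  let f : 𝕜 → 𝕜 := fun e => lcoeff n (toLaurent (tauNum ρ τ τoff (stepPath ρ a t e))
    * (1 + e • zA a) * toLaurent (W t)⁻¹) p q
  have hf : AnalyticOnNhd 𝕜 f ((fun ε : ℝ => (ε : 𝕜)) '' Set.Icc 0 1) := by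
    rintro _ ⟨ε, hε, rfl⟩
    have hmem : stepPath ρ a t (ε : 𝕜) ∈ Ω := hΩa t ht.1 ε hε
    refine analyticAt_lcoeff_mul_one_add_zA (fun j p q => ?_) _ n p q
    refine (analyticAt_coeff_tauNum hρ (hτ.analytic _ hmem)
      (fun α β h => hτ.analytic_off α β h _ hmem) j p q).comp ?_
    refine analyticAt_stepPath hρ ha t ?_
    rw [RCLike.norm_ofReal, abs_of_nonneg hε.1]
    exact hε.2
  have hconn : IsPreconnected ((fun ε : ℝ => (ε : 𝕜)) '' Set.Icc 0 1) :=
    isPreconnected_Icc.image _ RCLike.continuous_ofReal.continuousOn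
  have h0 : f =ᶠ[𝓝 0] fun _ => 0 := by
    filter_upwards [hnear, eventually_lcoeff_transfer_eq_zero hρ ha hW ht hn p q] with e he h
    rw [hscale, lcoeff_smul, Matrix.smul_apply, smul_eq_mul] at h
    exact (mul_eq_zero.1 h).resolve_left (inv_ne_zero he.2)
  have hf1 : f 1 = 0 := hf.eqOn_of_preconnected_of_eventuallyEq (fun _ _ => analyticAt_const) hconn
    ⟨0, by simp, by simp⟩ h0 ⟨1, by simp, by simp⟩
  rw [hscale, lcoeff_smul, Matrix.smul_apply, Matrix.zero_apply]
  exact smul_eq_zero_of_right _ hf1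

end DiscreteBaker

end AKNSD

theorem theorem3 {𝕜 : Type*} [RCLike 𝕜] {m : ℕ} (a : Fin m → 𝕜)
    (ρ : ℝ) (hρ : 0 < ρ) (ha : ∀ α, ρ * ‖a α‖ < 1)
    (Ω : Set (AKNSD.Times 𝕜 m)) (hΩ : IsOpen Ω)
    (hΩa : ∀ t ∈ Ω, ∀ ε ∈ Set.Icc (0 : ℝ) 1,
      t + AKNSD.stepVec ρ (fun α => (ε : 𝕜) * a α) ∈ Ω)
    (τ : AKNSD.Times 𝕜 m → 𝕜) (τoff : Fin m → Fin m → AKNSD.Times 𝕜 m → 𝕜)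
    (hτ : AKNSD.IsClassicalTau ρ a Ω τ τoff) :
    AKNSD.IsDiscreteBaker ρ a
      (fun n => {t | t + n • AKNSD.stepVec ρ a ∈ Ω ∧ AKNSD.discTau ρ a τ n t ≠ 0})
      (fun n => AKNSD.tauDressing ρ (AKNSD.discTau ρ a τ n)
        (fun α β => AKNSD.discTau ρ a (τoff α β) n)) := by
  open AKNSD in
  have hW := isAnalyticFlow_of_isClassicalTau hρ hΩ hτ
  have hdisc : ∀ n : ℤ, tauDressing ρ (discTau ρ a τ n) (fun α β => discTau ρ a (τoff α β) n)
      = fun t => tauDressing ρ τ τoff (t + n • stepVec ρ a) :=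
    fun n => funext fun t => tauDressing_discTau ρ a τ τoff n t
  simp only [hdisc]
  set W := tauDressing ρ τ τoff
  refine ⟨fun n t ht => hW.normalized _ ht, fun n t ht k α => ?_,
    fun n t => discPotential ρ a W (t + n • stepVec ρ a), fun n t ht => ?_⟩
  · rw [partialBaker_translate]
    exact hW.flow _ ht k α
  · have hsucc : t + (n + 1) • stepVec ρ a = t + n • stepVec ρ a + stepVec ρ a := by
      rw [add_smul, one_smul, add_assoc]
    obtain ⟨ht0, ht1⟩ := ht
    simp only [discTau, Set.mem_ofPred_eq, hsucc] at ht0 ht1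
    simp only [discL, hsucc, partialU_translate ρ _ _ (discPotential ρ a W)]
    set u := t + n • stepVec ρ a
    have hT : toLaurent (W (u + stepVec ρ a)) * (1 + zA a)
        = (1 + zA a - constMat (discPotential ρ a W u)) * toLaurent (W u) := by
      refine mul_one_add_zA_eq (hW.normalized _ ht1) (hW.normalized _ ht0) fun n hn => ?_
      simpa [transfer, stepPath] using lcoeff_transfer_one_eq_zero hρ ha hΩ hΩa hτ ht0 n hn
    refine ⟨fun F => ?_, ?_, fun k α F => ?_⟩
    · have h : toLaurent (W (u + stepVec ρ a)) * ((1 + zA a) * F n)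
          = (1 + zA a - constMat (discPotential ρ a W u)) * (toLaurent (W u) * F n) := by
        rw [← mul_assoc, hT, mul_assoc]
      rw [sub_sub (F (n + 1)), ← one_add_mul, mul_sub, h]
      noncomm_ring
    · rw [hT]
      noncomm_ring
    · rw [constMat_partialU_discPotential hW ht0 ht1 hT]
      noncomm_ring
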